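/- Call a positive integer a quasi-prime if it is $4$ or an odd prime. Define the weight of a group $G$ to be the minimal number of elements in a subset of $G$ whose normal closure is all of $G$. Let $a,b,c$ be distinct quasi-primes with $\{a,b,c\}\neq\{3,4,5\}$. Then the group $G$ with presentation \[ \langle u,x,y,z \mid u^2=xyz,\ x^a=y^b=z^c=1\rangle \] has weight $2$. -/

import Mathlib

/-- The weight of a group `G`: the least number of elements of a subset whose normal closure
is `G` (`⊤` if no finite subset has this property). -/
noncomputable def Group.weight (G : Type*) [Group G] : ℕ∞ :=
  ⨅ (S : Set G) (_ : Subgroup.normalClosure S = ⊤), S.encard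

/-- A positive integer is a quasi-prime if it is `4` or an odd prime. -/
def IsQuasiPrime (n : ℕ) : Prop :=
  n = 4 ∨ (n.Prime ∧ Odd n)

/-- The four generators `u, x, y, z`. -/
inductive Gen : Type
  | u
  | x
  | y
  | z

/-- The relators of the presentation `⟨u, x, y, z | u² = xyz, xᵃ = yᵇ = zᶜ = 1⟩`. -/
def relators (a b c : ℕ) : Set (FreeGroup Gen) :=
  {FreeGroup.of Gen.u ^ 2 * (FreeGroup.of Gen.x * FreeGroup.of Gen.y * FreeGroup.of Gen.z)⁻¹,
    FreeGroup.of Gen.x ^ a, FreeGroup.of Gen.y ^ b, FreeGroup.of Gen.z ^ c}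

/-- The group with presentation `⟨u, x, y, z | u² = xyz, xᵃ = yᵇ = zᶜ = 1⟩`. -/
abbrev OrbifoldQuotient (a b c : ℕ) : Type :=
  PresentedGroup (relators a b c)

open Quaternion

/-- The quaternion `i`. -/
def quatI : ℍ := ⟨0, 1, 0, 0⟩

/-- The quaternion `j`. -/
def quatJ : ℍ := ⟨0, 0, 1, 0⟩

@[simp] theorem quatI_re : quatI.re = 0 := rfl
@[simp] theorem quatI_imI : quatI.imI = 1 := rfl
@[simp] theorem quatI_imJ : quatI.imJ = 0 := rfl
@[simp] theorem quatI_imK : quatI.imK = 0 := rfl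
@[simp] theorem quatJ_re : quatJ.re = 0 := rfl
@[simp] theorem quatJ_imI : quatJ.imI = 0 := rfl
@[simp] theorem quatJ_imJ : quatJ.imJ = 1 := rfl
@[simp] theorem quatJ_imK : quatJ.imK = 0 := rfl

/-- The closed unit cube in `ℝ × ℝ × ℝ`. -/
abbrev unitCube : Set (ℝ × ℝ × ℝ) := Set.Icc 0 1

theorem quatI_mul_self : quatI * quatI = -1 := by
  ext <;> simp [Quaternion.re_mul, Quaternion.imI_mul, Quaternion.imJ_mul, Quaternion.imK_mul]
theorem quatJ_mul_self : quatJ * quatJ = -1 := by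
  ext <;> simp [Quaternion.re_mul, Quaternion.imI_mul, Quaternion.imJ_mul, Quaternion.imK_mul]
theorem quatI_mul_quatJ : quatI * quatJ = -(quatJ * quatI) := by
  ext <;> simp [Quaternion.re_mul, Quaternion.imI_mul, Quaternion.imJ_mul, Quaternion.imK_mul]
theorem quatI_ne_zero : quatI ≠ 0 := fun h => by simpa using congrArg QuaternionAlgebra.imI h
theorem quatJ_ne_zero : quatJ ≠ 0 := fun h => by simpa using congrArg QuaternionAlgebra.imJ h

theorem coeComplex_mul_quatJ (z : ℂ) :
    (z : ℍ) * quatJ = quatJ * ((starRingEnd ℂ z : ℂ) : ℍ) := by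
  ext <;> simp [Quaternion.re_mul, Quaternion.imI_mul, Quaternion.imJ_mul,
    Quaternion.imK_mul]

theorem quatJ_mul_coeComplex (z : ℂ) :
    quatJ * (z : ℍ) = ((starRingEnd ℂ z : ℂ) : ℍ) * quatJ := by
  ext <;> simp [Quaternion.re_mul, Quaternion.imI_mul, Quaternion.imJ_mul,
    Quaternion.imK_mul]

theorem coeComplex_inv (z : ℂ) : ((z⁻¹ : ℂ) : ℍ) = (z : ℍ)⁻¹ :=
  map_inv₀ ofComplex z

theorem coeComplex_injective {z w : ℂ} (h : (z : ℍ) = w) : z = w := by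
  apply Complex.ext
  · simpa using congrArg QuaternionAlgebra.re h
  · simpa using congrArg QuaternionAlgebra.imI h

theorem coeComplex_ne_zero {z : ℂ} (h : z ≠ 0) : (z : ℍ) ≠ 0 :=
  fun h' => h (coeComplex_injective (by simpa using h'))

theorem coeComplex_comm (z w : ℂ) : (z : ℍ) * w = w * z := by
  rw [← coeComplex_mul, ← coeComplex_mul, mul_comm]

theorem continuous_coeComplex : Continuous (fun z : ℂ => (z : ℍ)) :=
  ofComplex.toLinearMap.continuous_of_finiteDimensional

/-- The complex part of a quaternion. -/
def complexPart (q : ℍ) : ℂ := ⟨q.re, q.imI⟩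

theorem continuous_complexPart : Continuous complexPart := by
  have : complexPart = fun q : ℍ => (q.re : ℂ) + q.imI * Complex.I := by
    funext q; apply Complex.ext <;> simp [complexPart]
  rw [this]
  exact (Complex.continuous_ofReal.comp continuous_re).add
    ((Complex.continuous_ofReal.comp continuous_imI).mul continuous_const)

theorem coe_complexPart_of_comm {q : ℍ} (h : q * quatI = quatI * q) :
    ((complexPart q : ℂ) : ℍ) = q := by
  have h1 := congrArg QuaternionAlgebra.imJ h
  have h2 := congrArg QuaternionAlgebra.imK h
  simp [Quaternion.imJ_mul, Quaternion.imK_mul] at h1 h2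
  ext <;> simp [complexPart] <;> linarith

/-- If `f * v = v * i` and `f * v' = v' * i` then `v⁻¹ * v'` commutes with `i`. -/
theorem inv_mul_comm_quatI {f v v' : ℍ} (hv : v ≠ 0) (h : f * v = v * quatI)
    (h' : f * v' = v' * quatI) : (v⁻¹ * v') * quatI = quatI * (v⁻¹ * v') := by
  have : quatI * v⁻¹ = v⁻¹ * f := by
    rw [eq_inv_mul_iff_mul_eq₀ hv, ← mul_assoc, ← h, mul_assoc, mul_inv_cancel₀ hv, mul_one]
  rw [mul_assoc, ← h', ← mul_assoc, ← mul_assoc, this]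

theorem norm_eq_one_of_mul_self {f : ℍ} (h : f * f = -1) : ‖f‖ = 1 := by
  have h1 : ‖f‖ * ‖f‖ = 1 := by rw [← norm_mul, h]; simp
  nlinarith [norm_nonneg f]

theorem exists_conj_quatI {f : ℍ} (h : f * f = -1) : ∃ v : ℍ, v ≠ 0 ∧ f * v = v * quatI := by
  by_cases h0 : 1 - f * quatI = 0
  · refine ⟨quatJ, quatJ_ne_zero, ?_⟩
    have h1 : f * quatI = 1 := (sub_eq_zero.mp h0).symm
    have h2 : f = -quatI := by
      have := congrArg (· * quatI) h1
      simp only [mul_assoc, quatI_mul_self, mul_neg, mul_one, one_mul] at this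
      rw [← this, neg_neg]
    rw [h2, neg_mul, quatI_mul_quatJ, neg_neg]
  · refine ⟨_, h0, ?_⟩
    rw [mul_sub, sub_mul, ← mul_assoc, h, mul_assoc, quatI_mul_self]
    simp [add_comm]

theorem one_sub_mul_ne_zero {f g : ℍ} (hf : f * f = -1) (hd : dist f g < 2) :
    1 - g * f ≠ 0 := by
  intro h
  have h1 : g * f = 1 := (sub_eq_zero.mp h).symm
  have h2 : g = -f := by
    have := congrArg (· * f) h1
    simp only [mul_assoc, hf, mul_neg, mul_one, one_mul] at this
    rw [← this, neg_neg]
  rw [h2, dist_eq_norm, sub_neg_eq_add, ← two_smul ℝ f, norm_smul,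
    norm_eq_one_of_mul_self hf] at hd
  norm_num at hd

/-- Maps from a Euclidean ball to the sphere of imaginary units lift through the Hopf map. -/
theorem exists_hopf_lift_ball {E : Type*} [NormedAddCommGroup E] [NormedSpace ℝ E] [ProperSpace E]
    (F : E → ℍ) (hF : Continuous F) (hsq : ∀ p, F p * F p = -1) :
    ∃ V : E → ℍ, Continuous V ∧ ∀ p, ‖p‖ ≤ 1 → V p ≠ 0 ∧ F p * V p = V p * quatI := by
  have hu : UniformContinuousOn F (Metric.closedBall (0 : E) 1) :=
    (isCompact_closedBall _ _).uniformContinuousOn_of_continuous hF.continuousOn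
  obtain ⟨δ, hδ, hδ'⟩ := Metric.uniformContinuousOn_iff.mp hu 2 two_pos
  obtain ⟨n, hn⟩ := exists_nat_one_div_lt hδ
  have hn0 : (0 : ℝ) < n + 1 := by positivity
  have key : ∀ k : ℕ, k ≤ n + 1 → ∃ V : E → ℍ, Continuous V ∧ ∀ p, ‖p‖ ≤ 1 →
      V p ≠ 0 ∧ F (((k : ℝ) / (n + 1)) • p) * V p = V p * quatI := by
    intro k
    induction k with
    | zero =>
      intro _
      obtain ⟨v, hv, hv'⟩ := exists_conj_quatI (hsq 0)
      exact ⟨fun _ => v, continuous_const, fun p _ => ⟨hv, by simpa using hv'⟩⟩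
    | succ k ih =>
      intro hk
      obtain ⟨V, hV, hV'⟩ := ih (by omega)
      have hmem : ∀ p : E, ‖p‖ ≤ 1 → ∀ m : ℕ, m ≤ n + 1 →
          ((m : ℝ) / (n + 1)) • p ∈ Metric.closedBall (0 : E) 1 := by
        intro p hp m hm
        have : (m : ℝ) ≤ n + 1 := by exact_mod_cast hm
        rw [mem_closedBall_zero_iff, norm_smul, Real.norm_of_nonneg (by positivity)]
        exact mul_le_one₀ ((div_le_one hn0).mpr this) (norm_nonneg _) hp
      refine ⟨fun p =>
        (1 - F ((((k + 1 : ℕ) : ℝ) / (n + 1)) • p) * F (((k : ℝ) / (n + 1)) • p)) * V p,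
        by fun_prop, fun p hp => ?_⟩
      obtain ⟨h1, h2⟩ := hV' p hp
      refine ⟨mul_ne_zero (one_sub_mul_ne_zero (hsq _) ?_) h1, ?_⟩
      · apply hδ' _ (hmem p hp k (by omega)) _ (hmem p hp (k + 1) hk)
        rw [dist_eq_norm, ← sub_smul, norm_smul]
        have : (k : ℝ) / (n + 1) - ((k + 1 : ℕ) : ℝ) / (n + 1) = -(1 / (n + 1)) := by
          push_cast; field_simp; ring
        rw [this, norm_neg, Real.norm_of_nonneg (by positivity)]
        calc 1 / ((n : ℝ) + 1) * ‖p‖ ≤ 1 / ((n : ℝ) + 1) * 1 := by gcongr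
          _ < δ := by simpa using hn
      · rw [mul_assoc _ (V p), ← h2, ← mul_assoc, ← mul_assoc]
        congr 1
        rw [mul_sub, sub_mul, ← mul_assoc, hsq, mul_assoc, hsq]
        simp [add_comm]
  obtain ⟨V, hV, hV'⟩ := key (n + 1) le_rfl
  refine ⟨V, hV, fun p hp => ?_⟩
  have := hV' p hp
  rwa [show (((n + 1 : ℕ) : ℝ) / (n + 1)) = 1 by push_cast; field_simp, one_smul] at this

/-- Projection of the real line onto `[a, b]`. -/
def clampTo (a b x : ℝ) : ℝ := max a (min b x)

theorem continuous_clampTo (a b : ℝ) : Continuous (clampTo a b) := by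
  unfold clampTo; fun_prop

theorem clampTo_mem {a b : ℝ} (h : a ≤ b) (x : ℝ) : clampTo a b x ∈ Set.Icc a b := by
  unfold clampTo; constructor
  · exact le_max_left _ _
  · exact max_le h (min_le_left _ _)

theorem clampTo_of_mem {a b x : ℝ} (h : x ∈ Set.Icc a b) : clampTo a b x = x := by
  unfold clampTo; rw [min_eq_right h.2, max_eq_right h.1]

theorem exists_hopf_lift_cube (F : ℝ × ℝ × ℝ → ℍ) (hF : ContinuousOn F unitCube)
    (hsq : ∀ p ∈ unitCube, F p * F p = -1) :
    ∃ V : ℝ × ℝ × ℝ → ℍ, Continuous V ∧ (∀ p, V p ≠ 0) ∧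
      ∀ p ∈ unitCube, F p * V p = V p * quatI := by
  let cl : ℝ × ℝ × ℝ → ℝ × ℝ × ℝ := fun p => (clampTo 0 1 p.1, clampTo 0 1 p.2.1, clampTo 0 1 p.2.2)
  have hcl : Continuous cl := by
    have := continuous_clampTo 0 1
    fun_prop
  have hm : ∀ p, cl p ∈ unitCube := fun p => by
    have h := fun x => clampTo_mem (zero_le_one' ℝ) x
    exact ⟨⟨(h _).1, (h _).1, (h _).1⟩, ⟨(h _).2, (h _).2, (h _).2⟩⟩
  have he : ∀ p ∈ unitCube, cl p = p := fun p hp => by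
    obtain ⟨⟨h1, h2, h3⟩, ⟨h4, h5, h6⟩⟩ := hp
    exact Prod.ext (clampTo_of_mem ⟨h1, h4⟩)
      (Prod.ext (clampTo_of_mem ⟨h2, h5⟩) (clampTo_of_mem ⟨h3, h6⟩))
  obtain ⟨V, hV, hV'⟩ := exists_hopf_lift_ball (fun p => F (cl p))
    (hF.comp_continuous hcl hm) (fun p => hsq _ (hm p))
  have hn : ∀ p, ‖cl p‖ ≤ 1 := fun p => by
    obtain ⟨⟨h1, h2, h3⟩, ⟨h4, h5, h6⟩⟩ := hm p
    simp only [Prod.norm_def, sup_le_iff, Real.norm_eq_abs]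
    have h0 : (-1 : ℝ) ≤ 0 := by norm_num
    exact ⟨abs_le.mpr ⟨h0.trans h1, h4⟩, abs_le.mpr ⟨h0.trans h2, h5⟩,
      abs_le.mpr ⟨h0.trans h3, h6⟩⟩
  refine ⟨fun p => V (cl p), hV.comp hcl, fun p => (hV' _ (hn p)).1, fun p hp => ?_⟩
  have := (hV' _ (hn p)).2
  simp only [he p hp] at this ⊢
  exact this

/-- A nowhere vanishing continuous function on the plane has a continuous logarithm. -/
theorem exists_continuous_log (f : ℝ × ℝ → ℂ) (hf : Continuous f) (h0 : ∀ p, f p ≠ 0) :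
    ∃ L : ℝ × ℝ → ℂ, Continuous L ∧ ∀ p, f p = Complex.exp (L p) := by
  obtain ⟨L, ⟨-, hL⟩, -⟩ := Complex.isCoveringMapOn_exp.existsUnique_continuousMap_lifts
    ⟨f, hf⟩ (a₀ := 0) (e₀ := Complex.log (f 0)) (Complex.exp_log (h0 0)) (fun p => h0 p)
  exact ⟨L, L.continuous, fun p => (congrFun hL p).symm⟩

theorem exists_log_rectangle {a b c d : ℝ} (hab : a ≤ b) (hcd : c ≤ d) (f : ℝ × ℝ → ℍ)
    (hf : Continuous f)
    (h0 : ∀ t ∈ Set.Icc a b, ∀ q ∈ Set.Icc c d,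
      f (t, q) ≠ 0 ∧ f (t, q) * quatI = quatI * f (t, q)) :
    ∃ L : ℝ × ℝ → ℂ, Continuous L ∧ ∀ t ∈ Set.Icc a b, ∀ q ∈ Set.Icc c d,
      f (t, q) = ((Complex.exp (L (t, q)) : ℂ) : ℍ) := by
  let cl : ℝ × ℝ → ℝ × ℝ := fun p => (clampTo a b p.1, clampTo c d p.2)
  have hcl : Continuous cl := by
    have := continuous_clampTo a b
    have := continuous_clampTo c d
    fun_prop
  have hc : ∀ p, ((complexPart (f (cl p)) : ℂ) : ℍ) = f (cl p) := fun p =>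
    coe_complexPart_of_comm (h0 _ (clampTo_mem hab _) _ (clampTo_mem hcd _)).2
  obtain ⟨L, hL, hL'⟩ := exists_continuous_log (fun p => complexPart (f (cl p)))
    (continuous_complexPart.comp (hf.comp hcl)) (fun p h => by
      have h1 := hc p
      rw [h] at h1
      exact (h0 _ (clampTo_mem hab _) _ (clampTo_mem hcd _)).1 h1.symm)
  refine ⟨L, hL, fun t ht q hq => ?_⟩
  rw [← hL', hc]
  simp only [cl, clampTo_of_mem ht, clampTo_of_mem hq]

theorem exists_log_interval {a b : ℝ} (hab : a ≤ b) (f : ℝ → ℍ) (hf : Continuous f)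
    (h0 : ∀ t ∈ Set.Icc a b, f t ≠ 0 ∧ f t * quatI = quatI * f t) :
    ∃ L : ℝ → ℂ, Continuous L ∧ ∀ t ∈ Set.Icc a b, f t = ((Complex.exp (L t) : ℂ) : ℍ) := by
  obtain ⟨L, hL, hL'⟩ := exists_log_rectangle hab le_rfl (c := 0) (fun p => f p.1)
    (by fun_prop) (fun t ht q _ => h0 t ht)
  exact ⟨fun t => L (t, 0), by fun_prop, fun t ht => hL' t ht 0 ⟨le_rfl, le_rfl⟩⟩

/-- A continuous function on an interval whose exponential is constant is constant. -/
theorem eq_of_exp_eq_const {a b : ℝ} (hab : a ≤ b) (g : ℝ → ℂ) (hg : Continuous g) (w : ℂ)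
    (h : ∀ t ∈ Set.Icc a b, Complex.exp (g t) = w) : g a = g b := by
  let G : ℝ → ℝ := fun t => ((g (clampTo a b t) - g a) / (2 * Real.pi * Complex.I)).re
  have hcl := continuous_clampTo a b
  have hint : ∀ t, ∃ n : ℤ, (g (clampTo a b t) - g a) / (2 * Real.pi * Complex.I) = n := by
    intro t
    have h1 := (h _ (clampTo_mem hab t)).trans (h a ⟨le_rfl, hab⟩).symm
    obtain ⟨n, hn⟩ := Complex.exp_eq_exp_iff_exists_int.mp h1
    refine ⟨n, ?_⟩
    rw [hn, div_eq_iff Complex.two_pi_I_ne_zero]; ring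
  choose N hN using hint
  have hc : Continuous (fun t => (N t : ℝ)) := by
    have : (fun t => (N t : ℝ)) = G := by
      funext t; simp only [G, hN]; simp
    rw [this]; fun_prop
  have hN' : Continuous N := Int.isClosedEmbedding_coe_real.isInducing.continuous_iff.mpr hc
  have hconst : N a = N b := PreconnectedSpace.constant inferInstance hN'
  have h1 := hN a
  have h2 := hN b
  rw [clampTo_of_mem ⟨le_rfl, hab⟩, sub_self, zero_div] at h1
  rw [clampTo_of_mem ⟨hab, le_rfl⟩, ← hconst, ← h1, div_eq_zero_iff] at h2
  rcases h2 with h2 | h2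
  · exact (sub_eq_zero.mp h2).symm
  · exact absurd h2 Complex.two_pi_I_ne_zero

theorem coeComplex_neg (z : ℂ) : ((-z : ℂ) : ℍ) = -(z : ℍ) := map_neg ofComplex z

theorem exp_sub_eq_one_of_coe {x y : ℂ}
    (h : ((Complex.exp x : ℂ) : ℍ) = ((Complex.exp y : ℂ) : ℍ)) : Complex.exp (x - y) = 1 := by
  rw [Complex.exp_sub, coeComplex_injective h, div_self (Complex.exp_ne_zero _)]

/-- On a strip where the sphere map is constant along circles, the logarithmic holonomy of a lift,
corrected by the windings at the ends, does not change. -/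
theorem holonomy_eq_of_constant {a b : ℝ} (hab : a ≤ b) {S V : ℝ × ℝ → ℍ} (hV : Continuous V)
    (hV0 : ∀ p, V p ≠ 0)
    (hSV : ∀ t ∈ Set.Icc a b, ∀ q ∈ Set.Icc (0 : ℝ) 1, S (t, q) * V (t, q) = V (t, q) * quatI)
    (hS : ∀ t ∈ Set.Icc a b, ∀ q ∈ Set.Icc (0 : ℝ) 1, S (t, q) = S (t, 0))
    {C Ya Yb : ℝ → ℂ} (hC : Continuous C) (hYa : Continuous Ya) (hYb : Continuous Yb)
    (eC : ∀ t ∈ Set.Icc a b, (V (t, 0))⁻¹ * V (t, 1) = ((Complex.exp (C t) : ℂ) : ℍ))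
    (eYa : ∀ q ∈ Set.Icc (0 : ℝ) 1, (V (a, 0))⁻¹ * V (a, q) = ((Complex.exp (Ya q) : ℂ) : ℍ))
    (eYb : ∀ q ∈ Set.Icc (0 : ℝ) 1, (V (b, 0))⁻¹ * V (b, q) = ((Complex.exp (Yb q) : ℂ) : ℍ)) :
    C b - (Yb 1 - Yb 0) = C a - (Ya 1 - Ya 0) := by
  have z0 : (0 : ℝ) ∈ Set.Icc (0 : ℝ) 1 := ⟨le_rfl, zero_le_one⟩
  have z1 : (1 : ℝ) ∈ Set.Icc (0 : ℝ) 1 := ⟨zero_le_one, le_rfl⟩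
  have ma : a ∈ Set.Icc a b := ⟨le_rfl, hab⟩
  have mb : b ∈ Set.Icc a b := ⟨hab, le_rfl⟩
  obtain ⟨L, hL, eL⟩ := exists_log_rectangle hab zero_le_one
    (fun p => (V (p.1, 0))⁻¹ * V p)
    (((hV.comp (by fun_prop)).inv₀ fun p => hV0 _).mul hV)
    (fun t ht q hq => ⟨mul_ne_zero (inv_ne_zero (hV0 _)) (hV0 _),
      inv_mul_comm_quatI (hV0 _) (hSV t ht 0 z0) (by rw [← hS t ht q hq]; exact hSV t ht q hq)⟩)
  have h1 := eq_of_exp_eq_const hab (fun t => L (t, 0)) (by fun_prop) 1 (fun t ht => by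
    apply coeComplex_injective
    rw [← eL t ht 0 z0, inv_mul_cancel₀ (hV0 _), coeComplex_one])
  have h2 := eq_of_exp_eq_const hab (fun t => L (t, 1) - C t) (by fun_prop) 1 (fun t ht =>
    exp_sub_eq_one_of_coe ((eL t ht 1 z1).symm.trans (eC t ht)))
  have h3 := eq_of_exp_eq_const zero_le_one (fun q => L (a, q) - Ya q) (by fun_prop) 1
    (fun q hq => exp_sub_eq_one_of_coe ((eL a ma q hq).symm.trans (eYa q hq)))
  have h4 := eq_of_exp_eq_const zero_le_one (fun q => L (b, q) - Yb q) (by fun_prop) 1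
    (fun q hq => exp_sub_eq_one_of_coe ((eL b mb q hq).symm.trans (eYb q hq)))
  linear_combination -h1 + h2 + h3 - h4

theorem exp_mul_eq_mul_exp {v : ℍ} {σ : ℝ} (hσ : σ = 1 ∨ σ = -1)
    (h : (σ • quatI) * v = v * quatI) (θ : ℝ) :
    ((Complex.exp (θ * Complex.I) : ℂ) : ℍ) * v =
      v * ((Complex.exp (σ * θ * Complex.I) : ℂ) : ℍ) := by
  have key : ∀ x : ℝ, ((Complex.exp (x * Complex.I) : ℂ) : ℍ) =
      (Real.cos x : ℝ) • (1 : ℍ) + Real.sin x • quatI := by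
    intro x
    ext <;> simp [Complex.exp_ofReal_mul_I_re, Complex.exp_ofReal_mul_I_im]
  have h2 := key (σ * θ)
  push_cast at h2
  rw [key, h2, add_mul, mul_add, smul_mul_assoc, one_mul, mul_smul_comm, mul_one, smul_mul_assoc,
    mul_smul_comm, ← h]
  rcases hσ with rfl | rfl <;> simp

/-- On a strip where the sphere map is equivariant under rotation about the axis `i`, the corrected
logarithmic holonomy changes according to the poles at the two ends. -/
theorem holonomy_sub_of_equivariant {a b : ℝ} (hab : a ≤ b) {S V : ℝ × ℝ → ℍ} (hV : Continuous V)
    (hV0 : ∀ p, V p ≠ 0)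
    (hSV : ∀ t ∈ Set.Icc a b, ∀ q ∈ Set.Icc (0 : ℝ) 1, S (t, q) * V (t, q) = V (t, q) * quatI)
    (hS : ∀ t ∈ Set.Icc a b, ∀ q ∈ Set.Icc (0 : ℝ) 1,
      S (t, q) * ((Complex.exp ((Real.pi * q : ℝ) * Complex.I) : ℂ) : ℍ) =
        ((Complex.exp ((Real.pi * q : ℝ) * Complex.I) : ℂ) : ℍ) * S (t, 0))
    {σ τ : ℝ} (hσ : σ = 1 ∨ σ = -1) (hτ : τ = 1 ∨ τ = -1)
    (hSa : S (a, 0) = σ • quatI) (hSb : S (b, 0) = τ • quatI)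
    {C Ya Yb : ℝ → ℂ} (hC : Continuous C) (hYa : Continuous Ya) (hYb : Continuous Yb)
    (eC : ∀ t ∈ Set.Icc a b, (V (t, 0))⁻¹ * V (t, 1) = ((Complex.exp (C t) : ℂ) : ℍ))
    (eYa : ∀ q ∈ Set.Icc (0 : ℝ) 1, (V (a, 0))⁻¹ * V (a, q) = ((Complex.exp (Ya q) : ℂ) : ℍ))
    (eYb : ∀ q ∈ Set.Icc (0 : ℝ) 1, (V (b, 0))⁻¹ * V (b, q) = ((Complex.exp (Yb q) : ℂ) : ℍ)) :
    (C b - (Yb 1 - Yb 0)) - (C a - (Ya 1 - Ya 0)) = (σ - τ) * Real.pi * Complex.I := by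
  have z0 : (0 : ℝ) ∈ Set.Icc (0 : ℝ) 1 := ⟨le_rfl, zero_le_one⟩
  have z1 : (1 : ℝ) ∈ Set.Icc (0 : ℝ) 1 := ⟨zero_le_one, le_rfl⟩
  have ma : a ∈ Set.Icc a b := ⟨le_rfl, hab⟩
  have mb : b ∈ Set.Icc a b := ⟨hab, le_rfl⟩
  let R : ℝ → ℍ := fun q => ((Complex.exp ((Real.pi * q : ℝ) * Complex.I) : ℂ) : ℍ)
  have hR : Continuous R := continuous_coeComplex.comp (by fun_prop)
  have hR0 : ∀ q, R q ≠ 0 := fun q => coeComplex_ne_zero (Complex.exp_ne_zero _)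
  obtain ⟨L, hL, eL⟩ := exists_log_rectangle hab zero_le_one
    (fun p => (R p.2 * V (p.1, 0))⁻¹ * V p)
    ((((hR.comp continuous_snd).mul (hV.comp (by fun_prop))).inv₀
      fun p => mul_ne_zero (hR0 _) (hV0 _)).mul hV)
    (fun t ht q hq => ⟨mul_ne_zero (inv_ne_zero (mul_ne_zero (hR0 _) (hV0 _))) (hV0 _),
      inv_mul_comm_quatI (f := S (t, q)) (mul_ne_zero (hR0 _) (hV0 _))
        (by
          rw [← mul_assoc, hS t ht q hq, mul_assoc, hSV t ht 0 z0, ← mul_assoc])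
        (hSV t ht q hq)⟩)
  have h1 := eq_of_exp_eq_const hab (fun t => L (t, 0)) (by fun_prop) 1 (fun t ht => by
    apply coeComplex_injective
    rw [← eL t ht 0 z0]
    simp [R, inv_mul_cancel₀ (hV0 _)])
  have h2 := eq_of_exp_eq_const hab (fun t => L (t, 1) - C t) (by fun_prop) (-1) (fun t ht => by
    have h := eL t ht 1 z1
    have hR1 : R 1 = -1 := by
      simp only [R, mul_one, Complex.exp_pi_mul_I, coeComplex_neg, coeComplex_one]
    simp only [hR1, neg_mul, one_mul, inv_neg, eC t ht] at h
    rw [← coeComplex_neg] at h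
    rw [Complex.exp_sub, ← coeComplex_injective h, neg_div, div_self (Complex.exp_ne_zero _)])
  have hend : ∀ x (ρ : ℝ), x ∈ Set.Icc a b → ρ = 1 ∨ ρ = -1 → S (x, 0) = ρ • quatI →
      ∀ Y : ℝ → ℂ, Continuous Y →
      (∀ q ∈ Set.Icc (0 : ℝ) 1, (V (x, 0))⁻¹ * V (x, q) = ((Complex.exp (Y q) : ℂ) : ℍ)) →
      L (x, 0) - Y 0 = L (x, 1) - Y 1 + ρ * Real.pi * Complex.I := by
    intro x ρ hx hρ hSx Y hY eY
    have h3 := eq_of_exp_eq_const zero_le_one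
      (fun q : ℝ => L (x, q) - (Y q + -(ρ * (Real.pi * q : ℝ) * Complex.I))) (by fun_prop) 1
      (fun q hq => exp_sub_eq_one_of_coe (by
        rw [← eL x hx q hq, Complex.exp_add, mul_comm, coeComplex_mul, ← eY q hq, Complex.exp_neg,
          coeComplex_inv, ← mul_assoc, ← mul_inv_rev]
        simp only [R]
        rw [exp_mul_eq_mul_exp hρ (by rw [← hSx]; exact hSV x hx 0 z0)]))
    push_cast at h3
    linear_combination h3
  have h3 := hend a σ ma hσ hSa Ya hYa eYa
  have h4 := hend b τ mb hτ hSb Yb hYb eYb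
  linear_combination -h1 + h2 + h3 - h4

theorem exp_im_mul_I_of_exp_neg {M : ℂ} {ρ : ℝ} (hρ : 0 < ρ) (h : Complex.exp M = -(ρ : ℂ)) :
    Complex.exp (M.im * Complex.I) = -1 := by
  have h1 : Real.exp M.re = ρ := by
    rw [← Complex.norm_exp, h, norm_neg, Complex.norm_real, Real.norm_of_nonneg hρ.le]
  have h2 : Complex.exp M = Complex.exp M.re * Complex.exp (M.im * Complex.I) := by
    rw [← Complex.exp_add, Complex.re_add_im]
  rw [h, ← Complex.ofReal_exp, h1] at h2
  have h3 : (ρ : ℂ) ≠ 0 := by exact_mod_cast hρ.ne'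
  apply mul_left_cancel₀ h3
  rw [← h2]; ring

/-- The parity of the degree of an antipodal sphere map is odd. -/
theorem exp_half_holonomy_of_odd {S V : ℝ × ℝ → ℍ} (hV : Continuous V) (hV0 : ∀ p, V p ≠ 0)
    (hSV : ∀ t ∈ Set.Icc (0 : ℝ) 1, ∀ q ∈ Set.Icc (0 : ℝ) 1,
      S (t, q) * V (t, q) = V (t, q) * quatI)
    (hS : ∀ t ∈ Set.Icc (0 : ℝ) 1, ∀ q ∈ Set.Icc (0 : ℝ) (1 / 2),
      S (1 - t, q + 1 / 2) = -S (t, q))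
    {C Y₀ Y₁ : ℝ → ℂ} (hC : Continuous C) (hY₀ : Continuous Y₀) (hY₁ : Continuous Y₁)
    (eC : ∀ t ∈ Set.Icc (0 : ℝ) 1, (V (t, 0))⁻¹ * V (t, 1) = ((Complex.exp (C t) : ℂ) : ℍ))
    (eY₀ : ∀ q ∈ Set.Icc (0 : ℝ) 1, (V (0, 0))⁻¹ * V (0, q) = ((Complex.exp (Y₀ q) : ℂ) : ℍ))
    (eY₁ : ∀ q ∈ Set.Icc (0 : ℝ) 1, (V (1, 0))⁻¹ * V (1, q) = ((Complex.exp (Y₁ q) : ℂ) : ℍ)) :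
    Complex.exp (((C 1 - (Y₁ 1 - Y₁ 0)) - (C 0 - (Y₀ 1 - Y₀ 0))) / 2) = -1 := by
  have z0 : (0 : ℝ) ∈ Set.Icc (0 : ℝ) 1 := ⟨le_rfl, zero_le_one⟩
  have z1 : (1 : ℝ) ∈ Set.Icc (0 : ℝ) 1 := ⟨zero_le_one, le_rfl⟩
  have w0 : (0 : ℝ) ∈ Set.Icc (0 : ℝ) (1 / 2) := ⟨le_rfl, by norm_num⟩
  have w1 : (1 / 2 : ℝ) ∈ Set.Icc (0 : ℝ) (1 / 2) := ⟨by norm_num, le_rfl⟩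
  have hsub : ∀ q ∈ Set.Icc (0 : ℝ) (1 / 2), q ∈ Set.Icc (0 : ℝ) 1 :=
    fun q hq => ⟨hq.1, hq.2.trans (by norm_num)⟩
  have hshift : ∀ q ∈ Set.Icc (0 : ℝ) (1 / 2), q + 1 / 2 ∈ Set.Icc (0 : ℝ) 1 :=
    fun q hq => ⟨by linarith [hq.1], by linarith [hq.2]⟩
  have hflip : ∀ t ∈ Set.Icc (0 : ℝ) 1, 1 - t ∈ Set.Icc (0 : ℝ) 1 :=
    fun t ht => ⟨by linarith [ht.2], by linarith [ht.1]⟩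
  have jinv : quatJ⁻¹ = -quatJ := by
    rw [inv_eq_iff_eq_inv, eq_comm]
    exact inv_eq_of_mul_eq_one_left (by rw [mul_neg, quatJ_mul_self, neg_neg])
  obtain ⟨B, hB, eB⟩ := exists_log_rectangle zero_le_one (c := 0) (d := 1 / 2) (by norm_num)
    (fun p => (V p)⁻¹ * (V (1 - p.1, p.2 + 1 / 2) * quatJ))
    ((hV.inv₀ hV0).mul ((hV.comp (by fun_prop)).mul continuous_const))
    (fun t ht q hq => ⟨mul_ne_zero (inv_ne_zero (hV0 _)) (mul_ne_zero (hV0 _) quatJ_ne_zero),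
      inv_mul_comm_quatI (f := S (t, q)) (hV0 _) (hSV t ht q (hsub q hq)) (by
        have h := hSV (1 - t) (hflip t ht) (q + 1 / 2) (hshift q hq)
        rw [hS t ht q hq, neg_mul] at h
        rw [← mul_assoc, neg_eq_iff_eq_neg.mp h, mul_assoc _ quatJ, neg_mul, mul_assoc,
          quatI_mul_quatJ, mul_neg, neg_neg])⟩)
  simp only at eB
  have hJ : ∀ z : ℂ, quatJ * (z : ℍ) * quatJ = ((-(starRingEnd ℂ z) : ℂ) : ℍ) := fun z => by
    rw [quatJ_mul_coeComplex, mul_assoc, quatJ_mul_self, coeComplex_neg, mul_neg, mul_one]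
  have cexp : ∀ z : ℂ, starRingEnd ℂ (Complex.exp z) = Complex.exp (starRingEnd ℂ z) :=
    fun z => (Complex.exp_conj z).symm
  -- the relation between the edges `q = 0` and `q = 1 / 2`
  have h1 := eq_of_exp_eq_const zero_le_one
    (fun t => B (t, 1 / 2) - starRingEnd ℂ (C (1 - t) - B (1 - t, 0)))
    (hB.comp (by fun_prop) |>.sub (Complex.continuous_conj.comp (by fun_prop))) (-1) (fun t ht => by
      have e1 := eB t ht (1 / 2) w1
      have e2 := eB (1 - t) (hflip t ht) 0 w0
      have e3 := eC (1 - t) (hflip t ht)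
      rw [show (1 : ℝ) / 2 + 1 / 2 = 1 by norm_num] at e1
      rw [show 1 - (1 - t) = t by ring, zero_add, ← mul_assoc] at e2
      have e4 : (V (t, 1 / 2))⁻¹ * V (1 - t, 0) =
          quatJ * ((Complex.exp (B (1 - t, 0)) : ℂ) : ℍ)⁻¹ := by
        rw [← e2, mul_inv_rev, mul_inv_rev, inv_inv, ← mul_assoc,
          mul_inv_cancel₀ quatJ_ne_zero, one_mul]
      have e5 : ((Complex.exp (B (t, 1 / 2)) : ℂ) : ℍ) =
          quatJ * ((Complex.exp (C (1 - t) - B (1 - t, 0)) : ℂ) : ℍ) * quatJ := by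
        rw [← e1, sub_eq_neg_add (C (1 - t)), Complex.exp_add, coeComplex_mul, ← e3,
          Complex.exp_neg,
          coeComplex_inv, ← mul_assoc quatJ, ← e4]
        simp only [mul_assoc, mul_inv_cancel_left₀ (hV0 _)]
      rw [hJ] at e5
      rw [Complex.exp_sub, coeComplex_injective e5, cexp, neg_div,
        div_self (Complex.exp_ne_zero _)])
  -- the relation between the two ends
  set e : ℂ := -Complex.exp (B (0, 0) - starRingEnd ℂ (Y₁ (1 / 2))) with he
  have he0 : e ≠ 0 := neg_ne_zero.mpr (Complex.exp_ne_zero _)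
  have hg : (V (0, 0))⁻¹ * V (1, 0) = (e : ℍ) * quatJ := by
    have e1 := eB 0 z0 0 w0
    have e2 := eY₁ (1 / 2) (hsub _ w1)
    rw [sub_zero, zero_add] at e1
    have e3 : V (1, 1 / 2) = V (1, 0) * ((Complex.exp (Y₁ (1 / 2)) : ℂ) : ℍ) := by
      rw [← e2, mul_inv_cancel_left₀ (hV0 _)]
    rw [he, coeComplex_neg, Complex.exp_sub, div_eq_mul_inv, coeComplex_mul, ← e1, e3,
      mul_assoc (V (1, 0)), coeComplex_mul_quatJ, cexp, ← mul_assoc, mul_assoc _ (_ * _),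
      mul_assoc quatJ, coeComplex_inv,
      mul_inv_cancel₀ (coeComplex_ne_zero (Complex.exp_ne_zero _)), mul_one, neg_mul, mul_assoc,
      quatJ_mul_self, mul_neg, neg_neg, mul_one]
  have h2' : ∀ q ∈ Set.Icc (0 : ℝ) (1 / 2),
      Complex.exp (B (0, q) + Y₀ q - starRingEnd ℂ (Y₁ (q + 1 / 2))) = -e := fun q hq => by
    have e1 := eB 0 z0 q hq
    have e2 := eY₁ (q + 1 / 2) (hshift q hq)
    have e3 := eY₀ q (hsub q hq)
    rw [sub_zero] at e1
    have e4 : ((Complex.exp (Y₀ q + B (0, q)) : ℂ) : ℍ) =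
        (((e * -starRingEnd ℂ (Complex.exp (Y₁ (q + 1 / 2))) : ℂ)) : ℍ) := by
      rw [Complex.exp_add, coeComplex_mul, coeComplex_mul, ← hJ, ← e1, ← e2, ← e3,
        ← mul_assoc (e : ℍ), ← mul_assoc (e : ℍ), ← hg]
      simp only [mul_assoc, mul_inv_cancel_left₀ (hV0 _)]
    rw [Complex.exp_sub, add_comm, coeComplex_injective e4, cexp, mul_neg, neg_div,
      mul_div_cancel_right₀ _ (Complex.exp_ne_zero _)]
  have h3' : ∀ q ∈ Set.Icc (0 : ℝ) (1 / 2),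
      Complex.exp (B (1, q) + Y₁ q - starRingEnd ℂ (Y₀ (q + 1 / 2))) = starRingEnd ℂ e⁻¹ :=
    fun q hq => by
    have e1 := eB 1 z1 q hq
    have e2 := eY₀ (q + 1 / 2) (hshift q hq)
    have e3 := eY₁ q (hsub q hq)
    rw [sub_self] at e1
    have hg' : (V (1, 0))⁻¹ * V (0, 0) = -(quatJ * ((e⁻¹ : ℂ) : ℍ)) := by
      have := congrArg (·⁻¹) hg
      simp only [mul_inv_rev, inv_inv] at this
      rw [this, jinv, coeComplex_inv, neg_mul]
    have e4 : ((Complex.exp (Y₁ q + B (1, q)) : ℂ) : ℍ) =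
        ((starRingEnd ℂ (e⁻¹ * Complex.exp (Y₀ (q + 1 / 2))) : ℂ) : ℍ) := by
      rw [← neg_neg (starRingEnd ℂ _), coeComplex_neg, ← hJ, coeComplex_mul,
        ← mul_assoc quatJ, mul_assoc _ _ quatJ, ← neg_mul, ← hg', Complex.exp_add, coeComplex_mul,
        ← e1, ← e2, ← e3]
      simp only [mul_assoc, mul_inv_cancel_left₀ (hV0 _)]
    rw [Complex.exp_sub, add_comm, coeComplex_injective e4, map_mul, cexp,
      mul_div_cancel_right₀ _ (Complex.exp_ne_zero _)]
  have hhalf : (0 : ℝ) ≤ 1 / 2 := by norm_num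
  have h2 := eq_of_exp_eq_const hhalf
    (fun q => B (0, q) + Y₀ q - starRingEnd ℂ (Y₁ (q + 1 / 2)))
    (((hB.comp (by fun_prop)).add hY₀).sub (Complex.continuous_conj.comp (by fun_prop))) _ h2'
  have h3 := eq_of_exp_eq_const hhalf
    (fun q => B (1, q) + Y₁ q - starRingEnd ℂ (Y₀ (q + 1 / 2)))
    (((hB.comp (by fun_prop)).add hY₁).sub (Complex.continuous_conj.comp (by fun_prop))) _ h3'
  have h4 := h2' 0 w0
  have h5 := h3' 0 w0
  simp only [sub_zero, sub_self, zero_add, map_sub,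
    show (1 : ℝ) / 2 + 1 / 2 = 1 by norm_num] at h1 h2 h3 h4 h5
  set M : ℂ := Y₁ (1 / 2) - Y₀ (1 / 2) + Y₀ 0 - Y₁ 0 + B (0, 0) - B (1, 0) with hM
  have hMexp : Complex.exp M = -((Complex.normSq e *
      Real.exp (2 * (Y₁ (1 / 2)).re - 2 * (Y₀ (1 / 2)).re) : ℝ) : ℂ) := by
    have r1 : ∀ z : ℂ, ((2 * z.re : ℝ) : ℂ) = z + starRingEnd ℂ z := fun z =>
      (Complex.add_conj z).symm
    have : M = (B (0, 0) + Y₀ 0 - starRingEnd ℂ (Y₁ (1 / 2))) -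
        (B (1, 0) + Y₁ 0 - starRingEnd ℂ (Y₀ (1 / 2))) +
        ((2 * (Y₁ (1 / 2)).re - 2 * (Y₀ (1 / 2)).re : ℝ) : ℂ) := by
      rw [Complex.ofReal_sub, r1, r1, hM]; ring
    rw [this, Complex.exp_add, Complex.exp_sub, h4, h5, Complex.ofReal_mul, Complex.ofReal_exp,
      Complex.normSq_eq_conj_mul_self, map_inv₀, div_inv_eq_mul]
    ring
  have hfin := exp_im_mul_I_of_exp_neg (mul_pos (Complex.normSq_pos.mpr he0) (Real.exp_pos _)) hMexp
  have hD : starRingEnd ℂ (((C 1 - (Y₁ 1 - Y₁ 0)) - (C 0 - (Y₀ 1 - Y₀ 0))) / 2) =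
      M.im * Complex.I := by
    have r2 : (M.im : ℂ) * Complex.I = (M - starRingEnd ℂ M) / 2 := by
      rw [Complex.sub_conj]; push_cast; ring
    rw [r2, hM]
    simp only [map_sub, map_add, map_div₀, map_ofNat]
    linear_combination (-1 / 2 : ℂ) * h1 - (1 / 2 : ℂ) * h2 + (1 / 2 : ℂ) * h3
  have := congrArg (starRingEnd ℂ) hfin
  rw [← hD, ← Complex.exp_conj, Complex.conj_conj] at this
  simpa using this

theorem exp_half_sign_sub {σ τ : ℝ} (hσ : σ = 1 ∨ σ = -1) (hτ : τ = 1 ∨ τ = -1) :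
    Complex.exp ((σ - τ) * Real.pi * Complex.I / 2) = ((σ * τ : ℝ) : ℂ) := by
  rcases hσ with rfl | rfl <;> rcases hτ with rfl | rfl
  · simp
  · rw [show (((1 : ℝ) : ℂ) - ((-1 : ℝ) : ℂ)) * Real.pi * Complex.I / 2 = Real.pi * Complex.I by
      push_cast; ring, Complex.exp_pi_mul_I]; simp
  · rw [show (((-1 : ℝ) : ℂ) - ((1 : ℝ) : ℂ)) * Real.pi * Complex.I / 2 = -(Real.pi * Complex.I) by
      push_cast; ring, Complex.exp_neg, Complex.exp_pi_mul_I]; norm_num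
  · simp

/-- A homotopy of sphere maps from a map which is equivariant on two caps and degenerate between
them: the parity of the degree at the other end determines the product of the signs of the four
poles of the caps. -/
theorem prod_signs_of_sphere_homotopy (F : ℝ × ℝ × ℝ → ℍ) (hF : ContinuousOn F unitCube)
    (hsq : ∀ p ∈ unitCube, F p * F p = -1)
    (hper : ∀ r ∈ Set.Icc (0 : ℝ) 1, ∀ t ∈ Set.Icc (0 : ℝ) 1, F (r, t, 1) = F (r, t, 0))
    (hend₀ : ∀ r ∈ Set.Icc (0 : ℝ) 1, ∀ q ∈ Set.Icc (0 : ℝ) 1, F (r, 0, q) = F (r, 0, 0))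
    (hend₁ : ∀ r ∈ Set.Icc (0 : ℝ) 1, ∀ q ∈ Set.Icc (0 : ℝ) 1, F (r, 1, q) = F (r, 1, 0))
    (hcap : ∀ t ∈ Set.Icc (0 : ℝ) (1 / 3) ∪ Set.Icc (2 / 3) 1, ∀ q ∈ Set.Icc (0 : ℝ) 1,
      F (1, t, q) * ((Complex.exp ((Real.pi * q : ℝ) * Complex.I) : ℂ) : ℍ) =
        ((Complex.exp ((Real.pi * q : ℝ) * Complex.I) : ℂ) : ℍ) * F (1, t, 0))
    (hmid : ∀ t ∈ Set.Icc (1 / 3 : ℝ) (2 / 3), ∀ q ∈ Set.Icc (0 : ℝ) 1,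
      F (1, t, q) = F (1, t, 0))
    {σ₀ τ₀ τ₁ σ₁ : ℝ} (hσ₀ : σ₀ = 1 ∨ σ₀ = -1) (hτ₀ : τ₀ = 1 ∨ τ₀ = -1)
    (hτ₁ : τ₁ = 1 ∨ τ₁ = -1) (hσ₁ : σ₁ = 1 ∨ σ₁ = -1)
    (F₀ : F (1, 0, 0) = σ₀ • quatI) (F₁ : F (1, 1 / 3, 0) = τ₀ • quatI)
    (F₂ : F (1, 2 / 3, 0) = τ₁ • quatI) (F₃ : F (1, 1, 0) = σ₁ • quatI) :
    ((∀ t ∈ Set.Icc (0 : ℝ) 1, ∀ q ∈ Set.Icc (0 : ℝ) 1, F (0, t, q) = F (0, t, 0)) →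
      σ₀ * τ₀ * (τ₁ * σ₁) = 1) ∧
    ((∀ t ∈ Set.Icc (0 : ℝ) 1, ∀ q ∈ Set.Icc (0 : ℝ) (1 / 2),
      F (0, 1 - t, q + 1 / 2) = -F (0, t, q)) → σ₀ * τ₀ * (τ₁ * σ₁) = -1) := by
  have z0 : (0 : ℝ) ∈ Set.Icc (0 : ℝ) 1 := ⟨le_rfl, zero_le_one⟩
  have z1 : (1 : ℝ) ∈ Set.Icc (0 : ℝ) 1 := ⟨zero_le_one, le_rfl⟩
  have z3 : (1 / 3 : ℝ) ∈ Set.Icc (0 : ℝ) 1 := by constructor <;> norm_num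
  have z4 : (2 / 3 : ℝ) ∈ Set.Icc (0 : ℝ) 1 := by constructor <;> norm_num
  have hmem : ∀ r ∈ Set.Icc (0 : ℝ) 1, ∀ t ∈ Set.Icc (0 : ℝ) 1, ∀ q ∈ Set.Icc (0 : ℝ) 1,
      (r, t, q) ∈ unitCube := fun r hr t ht q hq =>
    ⟨⟨hr.1, ht.1, hq.1⟩, ⟨hr.2, ht.2, hq.2⟩⟩
  obtain ⟨V, hV, hV0, hFV'⟩ := exists_hopf_lift_cube F hF hsq
  have hFV : ∀ r ∈ Set.Icc (0 : ℝ) 1, ∀ t ∈ Set.Icc (0 : ℝ) 1, ∀ q ∈ Set.Icc (0 : ℝ) 1,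
      F (r, t, q) * V (r, t, q) = V (r, t, q) * quatI := fun r hr t ht q hq =>
    hFV' _ (hmem r hr t ht q hq)
  obtain ⟨C, hC, eC⟩ := exists_log_rectangle zero_le_one zero_le_one
    (fun p => (V (p.1, p.2, 0))⁻¹ * V (p.1, p.2, 1))
    (((hV.comp (by fun_prop)).inv₀ fun _ => hV0 _).mul (hV.comp (by fun_prop)))
    (fun r hr t ht => ⟨mul_ne_zero (inv_ne_zero (hV0 _)) (hV0 _),
      inv_mul_comm_quatI (hV0 _) (hFV r hr t ht 0 z0)
        (by rw [← hper r hr t ht]; exact hFV r hr t ht 1 z1)⟩)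
  obtain ⟨Y₀, hY₀, eY₀⟩ := exists_log_rectangle zero_le_one zero_le_one
    (fun p => (V (p.1, 0, 0))⁻¹ * V (p.1, 0, p.2))
    (((hV.comp (by fun_prop)).inv₀ fun _ => hV0 _).mul (hV.comp (by fun_prop)))
    (fun r hr q hq => ⟨mul_ne_zero (inv_ne_zero (hV0 _)) (hV0 _),
      inv_mul_comm_quatI (hV0 _) (hFV r hr 0 z0 0 z0)
        (by rw [← hend₀ r hr q hq]; exact hFV r hr 0 z0 q hq)⟩)
  obtain ⟨Y₁, hY₁, eY₁⟩ := exists_log_rectangle zero_le_one zero_le_one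
    (fun p => (V (p.1, 1, 0))⁻¹ * V (p.1, 1, p.2))
    (((hV.comp (by fun_prop)).inv₀ fun _ => hV0 _).mul (hV.comp (by fun_prop)))
    (fun r hr q hq => ⟨mul_ne_zero (inv_ne_zero (hV0 _)) (hV0 _),
      inv_mul_comm_quatI (hV0 _) (hFV r hr 1 z1 0 z0)
        (by rw [← hend₁ r hr q hq]; exact hFV r hr 1 z1 q hq)⟩)
  have hmidlog : ∀ t ∈ Set.Icc (1 / 3 : ℝ) (2 / 3), ∃ Y : ℝ → ℂ, Continuous Y ∧
      ∀ q ∈ Set.Icc (0 : ℝ) 1, (V (1, t, 0))⁻¹ * V (1, t, q) = ((Complex.exp (Y q) : ℂ) : ℍ) := by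
    intro t ht
    have ht' : t ∈ Set.Icc (0 : ℝ) 1 := ⟨z3.1.trans ht.1, ht.2.trans z4.2⟩
    exact exists_log_interval zero_le_one (fun q => (V (1, t, 0))⁻¹ * V (1, t, q))
      (continuous_const.mul (hV.comp (by fun_prop)))
      (fun q hq => ⟨mul_ne_zero (inv_ne_zero (hV0 _)) (hV0 _),
        inv_mul_comm_quatI (hV0 _) (hFV 1 z1 t ht' 0 z0)
          (by rw [← hmid t ht q hq]; exact hFV 1 z1 t ht' q hq)⟩)
  obtain ⟨Y₂, hY₂, eY₂⟩ := hmidlog (1 / 3) (by constructor <;> norm_num)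
  obtain ⟨Y₃, hY₃, eY₃⟩ := hmidlog (2 / 3) (by constructor <;> norm_num)
  simp only at eC eY₀ eY₁
  have hinv := eq_of_exp_eq_const zero_le_one
    (fun r => (C (r, 1) - (Y₁ (r, 1) - Y₁ (r, 0))) - (C (r, 0) - (Y₀ (r, 1) - Y₀ (r, 0))))
    (by fun_prop) 1 (fun r hr => by
      have e1 := exp_sub_eq_one_of_coe ((eC r hr 1 z1).symm.trans (eY₁ r hr 1 z1))
      have e2 := exp_sub_eq_one_of_coe ((eC r hr 0 z0).symm.trans (eY₀ r hr 1 z1))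
      have e3 : Complex.exp (Y₁ (r, 0)) = 1 := coeComplex_injective (by
        rw [← eY₁ r hr 0 z0, inv_mul_cancel₀ (hV0 _), coeComplex_one])
      have e4 : Complex.exp (Y₀ (r, 0)) = 1 := coeComplex_injective (by
        rw [← eY₀ r hr 0 z0, inv_mul_cancel₀ (hV0 _), coeComplex_one])
      rw [show (C (r, 1) - (Y₁ (r, 1) - Y₁ (r, 0))) - (C (r, 0) - (Y₀ (r, 1) - Y₀ (r, 0))) =
        (C (r, 1) - Y₁ (r, 1) + Y₁ (r, 0)) - (C (r, 0) - Y₀ (r, 1) + Y₀ (r, 0)) by ring,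
        Complex.exp_sub, Complex.exp_add, Complex.exp_add, e1, e2, e3, e4]
      simp)
  have hV₁ : Continuous fun p : ℝ × ℝ => V (1, p) := hV.comp (by fun_prop)
  have s1 := holonomy_sub_of_equivariant (a := 0) (b := 1 / 3) (by norm_num)
    (S := fun p => F (1, p)) hV₁ (fun _ => hV0 _)
    (fun t ht q hq => hFV 1 z1 t ⟨ht.1, ht.2.trans z3.2⟩ q hq)
    (fun t ht q hq => hcap t (Or.inl ht) q hq) hσ₀ hτ₀ F₀ F₁
    (C := fun t => C (1, t)) (Ya := fun q => Y₀ (1, q)) (Yb := Y₂)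
    (by fun_prop) (by fun_prop) hY₂
    (fun t ht => eC 1 z1 t ⟨ht.1, ht.2.trans z3.2⟩) (eY₀ 1 z1) eY₂
  have s2 := holonomy_eq_of_constant (a := 1 / 3) (b := 2 / 3) (by norm_num)
    (S := fun p => F (1, p)) hV₁ (fun _ => hV0 _)
    (fun t ht q hq => hFV 1 z1 t ⟨z3.1.trans ht.1, ht.2.trans z4.2⟩ q hq) hmid
    (C := fun t => C (1, t)) (by fun_prop) hY₂ hY₃
    (fun t ht => eC 1 z1 t ⟨z3.1.trans ht.1, ht.2.trans z4.2⟩) eY₂ eY₃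
  have s3 := holonomy_sub_of_equivariant (a := 2 / 3) (b := 1) (by norm_num)
    (S := fun p => F (1, p)) hV₁ (fun _ => hV0 _)
    (fun t ht q hq => hFV 1 z1 t ⟨z4.1.trans ht.1, ht.2⟩ q hq)
    (fun t ht q hq => hcap t (Or.inr ht) q hq) hτ₁ hσ₁ F₂ F₃
    (C := fun t => C (1, t)) (Ya := Y₃) (Yb := fun q => Y₁ (1, q))
    (by fun_prop) hY₃ (by fun_prop)
    (fun t ht => eC 1 z1 t ⟨z4.1.trans ht.1, ht.2⟩) eY₃ (eY₁ 1 z1)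
  have hone : (C (0, 1) - (Y₁ (0, 1) - Y₁ (0, 0))) - (C (0, 0) - (Y₀ (0, 1) - Y₀ (0, 0))) =
      (σ₀ - τ₀) * Real.pi * Complex.I + (τ₁ - σ₁) * Real.pi * Complex.I := by
    rw [hinv]; linear_combination s1 + s2 + s3
  have hpar : Complex.exp (((C (0, 1) - (Y₁ (0, 1) - Y₁ (0, 0))) -
      (C (0, 0) - (Y₀ (0, 1) - Y₀ (0, 0)))) / 2) = ((σ₀ * τ₀ * (τ₁ * σ₁) : ℝ) : ℂ) := by
    rw [hone, add_div, Complex.exp_add, exp_half_sign_sub hσ₀ hτ₀, exp_half_sign_sub hτ₁ hσ₁]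
    push_cast; ring
  have hV₀ : Continuous fun p : ℝ × ℝ => V (0, p) := hV.comp (by fun_prop)
  constructor
  · intro hconst
    have s := holonomy_eq_of_constant zero_le_one
      (S := fun p => F (0, p)) hV₀ (fun _ => hV0 _) (hFV 0 z0) hconst
      (C := fun t => C (0, t)) (Ya := fun q => Y₀ (0, q)) (Yb := fun q => Y₁ (0, q))
      (by fun_prop) (by fun_prop) (by fun_prop) (eC 0 z0) (eY₀ 0 z0) (eY₁ 0 z0)
    rw [s, sub_self, zero_div, Complex.exp_zero] at hpar
    exact_mod_cast hpar.symm
  · intro hodd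
    have s := exp_half_holonomy_of_odd
      (S := fun p => F (0, p)) hV₀ (fun _ => hV0 _) (hFV 0 z0) hodd
      (C := fun t => C (0, t)) (Y₀ := fun q => Y₀ (0, q)) (Y₁ := fun q => Y₁ (0, q))
      (by fun_prop) (by fun_prop) (by fun_prop) (eC 0 z0) (eY₀ 0 z0) (eY₁ 0 z0)
    rw [s] at hpar
    exact_mod_cast hpar.symm

open Classical in
/-- A nonzero quaternion as a unit (and `1` for the zero quaternion). -/
noncomputable def quatUnit (q : ℍ) : ℍˣ := if h : q ≠ 0 then Units.mk0 q h else 1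

theorem val_quatUnit {q : ℍ} (h : q ≠ 0) : (quatUnit q : ℍ) = q := by
  simp [quatUnit, h]

/-- The value of a word under an assignment of nonzero quaternions to the generators. -/
noncomputable def wordVal (f : Gen → ℍ) (w : FreeGroup Gen) : ℍ :=
  (FreeGroup.lift (fun g => quatUnit (f g)) w : ℍˣ)

/-- The exponent sum of a word with weights `v`. -/
def expSum (v : Gen → ℤ) (w : FreeGroup Gen) : ℤ :=
  (FreeGroup.lift (fun g => Multiplicative.ofAdd (v g)) w).toAdd

theorem wordVal_one (f : Gen → ℍ) : wordVal f 1 = 1 := by simp [wordVal]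
theorem wordVal_mul (f : Gen → ℍ) (v w : FreeGroup Gen) :
    wordVal f (v * w) = wordVal f v * wordVal f w := by simp [wordVal]
theorem wordVal_inv (f : Gen → ℍ) (w : FreeGroup Gen) : wordVal f w⁻¹ = (wordVal f w)⁻¹ := by
  simp [wordVal]
theorem wordVal_of {f : Gen → ℍ} {g : Gen} (h : f g ≠ 0) : wordVal f (FreeGroup.of g) = f g := by
  simp [wordVal, val_quatUnit h]
theorem wordVal_ne_zero (f : Gen → ℍ) (w : FreeGroup Gen) : wordVal f w ≠ 0 := Units.ne_zero _

theorem expSum_one (v : Gen → ℤ) : expSum v 1 = 0 := by simp [expSum]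
theorem expSum_mul (v : Gen → ℤ) (w w' : FreeGroup Gen) :
    expSum v (w * w') = expSum v w + expSum v w' := by simp [expSum]
theorem expSum_inv (v : Gen → ℤ) (w : FreeGroup Gen) : expSum v w⁻¹ = -expSum v w := by
  simp [expSum]
theorem expSum_of (v : Gen → ℤ) (g : Gen) : expSum v (FreeGroup.of g) = v g := by simp [expSum]

theorem continuousOn_wordVal {E : Type*} [TopologicalSpace E] {s : Set E} {f : E → Gen → ℍ}
    (hf : ∀ g, ContinuousOn (fun p => f p g) s) (h0 : ∀ p ∈ s, ∀ g, f p g ≠ 0)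
    (w : FreeGroup Gen) : ContinuousOn (fun p => wordVal (f p) w) s := by
  induction w using FreeGroup.induction_on with
  | C1 => simpa only [wordVal_one] using continuousOn_const
  | of g => exact (hf g).congr fun p hp => wordVal_of (h0 p hp g)
  | inv_of g ih =>
    simp only [wordVal_inv]
    exact ih.inv₀ fun p _ => wordVal_ne_zero _ _
  | mul v w hv hw =>
    simp only [wordVal_mul]
    exact hv.mul hw

theorem wordVal_conj {f : Gen → ℍ} (h0 : ∀ g, f g ≠ 0) {R : ℍ} (hR : R ≠ 0) (w : FreeGroup Gen) :
    wordVal (fun g => R * f g * R⁻¹) w = R * wordVal f w * R⁻¹ := by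
  induction w using FreeGroup.induction_on with
  | C1 => simp [wordVal_one, hR]
  | of g =>
    rw [wordVal_of (h0 g), wordVal_of]
    exact mul_ne_zero (mul_ne_zero hR (h0 g)) (inv_ne_zero hR)
  | inv_of g ih =>
    rw [wordVal_inv, ih, wordVal_inv, mul_inv_rev, mul_inv_rev, inv_inv, mul_assoc]
  | mul v w hv hw =>
    rw [wordVal_mul, hv, hw, wordVal_mul]
    simp only [mul_assoc, inv_mul_cancel_left₀ hR]

theorem wordVal_sign {f f' : Gen → ℍ} (h0 : ∀ g, f g ≠ 0) {v : Gen → ℤ}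
    (h : ∀ g, f' g = (-1) ^ v g * f g) (w : FreeGroup Gen) :
    wordVal f' w = (-1) ^ expSum v w * wordVal f w := by
  have hn : (-1 : ℍ) ≠ 0 := by simp
  have hcomm : ∀ (n : ℤ) (q : ℍ), q * (-1) ^ n = (-1) ^ n * q := fun n q =>
    ((Commute.neg_one_left q).zpow_left₀ n).eq.symm
  induction w using FreeGroup.induction_on with
  | C1 => simp [wordVal_one, expSum_one]
  | of g =>
    rw [wordVal_of (h0 g), wordVal_of, expSum_of, h]
    rw [h]; exact mul_ne_zero (zpow_ne_zero _ hn) (h0 g)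
  | inv_of g ih =>
    rw [wordVal_inv, ih, wordVal_inv, mul_inv_rev, expSum_inv, ← zpow_neg, hcomm]
  | mul w w' hw hw' =>
    rw [wordVal_mul, hw, hw', wordVal_mul, expSum_mul, zpow_add₀ hn]
    simp only [mul_assoc]
    rw [← mul_assoc (wordVal f w), hcomm]
    simp only [mul_assoc]

theorem wordVal_exp {f : Gen → ℍ} {c : Gen → ℂ}
    (h : ∀ g, f g = ((Complex.exp (c g) : ℂ) : ℍ)) {v : Gen → Gen → ℤ}
    (hv : ∀ c : Gen → ℂ, ∀ g, c g = v .u g * c .u + v .x g * c .x + v .y g * c .y + v .z g * c .z)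
    (w : FreeGroup Gen) :
    wordVal f w = ((Complex.exp (expSum (v .u) w * c .u + expSum (v .x) w * c .x +
      expSum (v .y) w * c .y + expSum (v .z) w * c .z) : ℂ) : ℍ) := by
  induction w using FreeGroup.induction_on with
  | C1 => simp [wordVal_one, expSum_one]
  | of g =>
    rw [wordVal_of, h]
    · simp only [expSum_of]
      rw [← hv c g]
    · rw [h]; exact coeComplex_ne_zero (Complex.exp_ne_zero _)
  | inv_of g ih =>
    rw [wordVal_inv, ih, ← coeComplex_inv, ← Complex.exp_neg]
    simp only [expSum_inv]
    push_cast
    ring_nf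
  | mul w w' hw hw' =>
    rw [wordVal_mul, hw, hw', ← coeComplex_mul, ← Complex.exp_add]
    simp only [expSum_mul]
    push_cast
    ring_nf

theorem quatUnit_comm_of_im_eq_zero {q : ℍˣ} (h : (q : ℍ).im = 0) : MulAut.conj q = 1 := by
  ext p : 1
  rw [MulAut.conj_apply, MulAut.one_apply, mul_inv_eq_iff_eq_mul]
  apply Units.ext
  rw [Units.val_mul, Units.val_mul, ← re_add_im (q : ℍ), h, add_zero]
  exact coe_commutes _ _

theorem im_eq_zero_of_conj_eq_one {q : ℍˣ} (h : MulAut.conj q = 1) : (q : ℍ).im = 0 := by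
  have hc : ∀ p : ℍ, p ≠ 0 → (q : ℍ) * p = p * q := fun p hp => by
    have := congrArg (fun φ : MulAut ℍˣ => φ (Units.mk0 p hp)) h
    simp only [MulAut.conj_apply, MulAut.one_apply, mul_inv_eq_iff_eq_mul] at this
    exact congrArg Units.val this
  have hI := hc quatI quatI_ne_zero
  have hJ := hc quatJ quatJ_ne_zero
  have h1 := congrArg QuaternionAlgebra.imJ hI
  have h2 := congrArg QuaternionAlgebra.imK hI
  have h3 := congrArg QuaternionAlgebra.imK hJ
  simp [Quaternion.imJ_mul, Quaternion.imK_mul] at h1 h2 h3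
  ext <;> simp <;> linarith

/-- A projective quaternionic representation of the group which is not central does not kill a
normal generator. -/
theorem im_wordVal_ne_zero {a b c : ℕ} {w : FreeGroup Gen}
    (hw : Subgroup.normalClosure {PresentedGroup.mk (relators a b c) w} = ⊤)
    {f : Gen → ℍ} (h0 : ∀ g, f g ≠ 0)
    (hu : ∃ s : ℝ, f .u * f .u = s • (f .x * f .y * f .z))
    (hx : (f .x ^ a).im = 0) (hy : (f .y ^ b).im = 0) (hz : (f .z ^ c).im = 0)
    (hne : (f .x).im ≠ 0) : (wordVal f w).im ≠ 0 := by
  intro hW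
  let φ : FreeGroup Gen →* ℍˣ := FreeGroup.lift (fun g => quatUnit (f g))
  have hφ : ∀ v, ((φ v : ℍˣ) : ℍ) = wordVal f v := fun v => rfl
  have hlift : FreeGroup.lift (fun g => MulAut.conj (quatUnit (f g))) = MulAut.conj.comp φ := by
    ext g : 1; simp [φ]
  have hpow : ∀ (g : Gen) (n : ℕ), wordVal f (FreeGroup.of g ^ n) = f g ^ n := fun g n => by
    rw [← hφ, map_pow, Units.val_pow_eq_pow_val, hφ, wordVal_of (h0 g)]
  have hrel : ∀ r ∈ relators a b c,
      FreeGroup.lift (fun g => MulAut.conj (quatUnit (f g))) r = 1 := by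
    intro r hr
    rw [hlift, MonoidHom.comp_apply]
    apply quatUnit_comm_of_im_eq_zero
    rw [hφ]
    rcases hr with rfl | rfl | rfl | rfl
    · obtain ⟨s, hs⟩ := hu
      rw [wordVal_mul, wordVal_inv, wordVal_mul, wordVal_mul, hpow, wordVal_of (h0 _),
        wordVal_of (h0 _), wordVal_of (h0 _), pow_two, hs, smul_mul_assoc, mul_inv_cancel₀
        (mul_ne_zero (mul_ne_zero (h0 _) (h0 _)) (h0 _))]
      simp
    · rw [hpow, hx]
    · rw [hpow, hy]
    · rw [hpow, hz]
  let ρ : OrbifoldQuotient a b c →* MulAut ℍˣ := PresentedGroup.toGroup hrel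
  have hρ : ∀ v, ρ (PresentedGroup.mk _ v) = MulAut.conj (φ v) := fun v => by
    rw [← MonoidHom.comp_apply MulAut.conj, ← hlift]; rfl
  have hker : ρ.ker = ⊤ := by
    rw [eq_top_iff, ← hw]
    apply Subgroup.normalClosure_le_normal
    rintro _ rfl
    rw [SetLike.mem_coe, MonoidHom.mem_ker]
    exact (hρ w).trans (quatUnit_comm_of_im_eq_zero hW)
  have hx1 : ρ (PresentedGroup.mk _ (FreeGroup.of .x)) = 1 := by
    rw [← MonoidHom.mem_ker, hker]; trivial
  rw [hρ] at hx1
  have := im_eq_zero_of_conj_eq_one hx1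
  rw [hφ, wordVal_of (h0 _)] at this
  exact hne this

theorem im_pow_eq_zero {q : ℍ} {θ : ℝ} (hre : q.re = Real.cos θ) (hq : normSq q = 1)
    (hs : Real.sin θ ≠ 0) {n k : ℕ} (hn : n * θ = k * Real.pi) : (q ^ n).im = 0 := by
  let e : ℍ := (Real.sin θ)⁻¹ • q.im
  have he : e * e = -1 := by
    have h1 : q.im * q.im = -((Real.sin θ ^ 2 : ℝ) : ℍ) := by
      have h2 : normSq q.im = Real.sin θ ^ 2 := by
        rw [normSq_def'] at hq ⊢
        simp only [re_im, imI_im, imJ_im, imK_im]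
        rw [hre] at hq
        linarith [Real.sin_sq_add_cos_sq θ]
      rw [← pow_two, im_sq, h2]
    simp only [e, smul_mul_assoc, mul_smul_comm, smul_smul]
    rw [h1, smul_neg, smul_coe]
    field_simp
    simp
  let φ : ℂ →ₐ[ℝ] ℍ := Complex.lift ⟨e, he⟩
  have hφ : q = φ (Complex.exp (θ * Complex.I)) := by
    simp only [φ, Complex.lift_apply, Complex.liftAux_apply, Complex.exp_ofReal_mul_I_re,
      Complex.exp_ofReal_mul_I_im, e, smul_smul, mul_inv_cancel₀ hs, one_smul]
    rw [← hre, algebraMap_def, re_add_im]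
  have h3 : Complex.exp (θ * Complex.I) ^ n = ((Real.cos (n * θ) : ℝ) : ℂ) := by
    rw [← Complex.exp_nat_mul, ← mul_assoc]
    have : (n : ℂ) * θ = ((n * θ : ℝ) : ℂ) := by push_cast; rfl
    rw [this]
    apply Complex.ext
    · rw [Complex.exp_ofReal_mul_I_re, Complex.ofReal_re]
    · rw [Complex.exp_ofReal_mul_I_im, Complex.ofReal_im, hn, Real.sin_nat_mul_pi]
  rw [hφ, ← map_pow, h3]
  have : φ ((Real.cos (n * θ) : ℝ) : ℂ) = algebraMap ℝ ℍ (Real.cos (n * θ)) :=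
    φ.commutes _
  rw [this, algebraMap_def, im_coe]

/-- The quaternion with given components. -/
def quatMk (a b c d : ℝ) : ℍ := ⟨a, b, c, d⟩

@[simp] theorem quatMk_re (a b c d : ℝ) : (quatMk a b c d).re = a := rfl
@[simp] theorem quatMk_imI (a b c d : ℝ) : (quatMk a b c d).imI = b := rfl
@[simp] theorem quatMk_imJ (a b c d : ℝ) : (quatMk a b c d).imJ = c := rfl
@[simp] theorem quatMk_imK (a b c d : ℝ) : (quatMk a b c d).imK = d := rfl

theorem normSq_quatMk (a b c d : ℝ) :
    normSq (quatMk a b c d) = a ^ 2 + b ^ 2 + c ^ 2 + d ^ 2 := normSq_def' _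

theorem continuousOn_quatMk {E : Type*} [TopologicalSpace E] {s : Set E} {a b c d : E → ℝ}
    (ha : ContinuousOn a s) (hb : ContinuousOn b s) (hc : ContinuousOn c s)
    (hd : ContinuousOn d s) : ContinuousOn (fun p => quatMk (a p) (b p) (c p) (d p)) s := by
  have : (fun p => quatMk (a p) (b p) (c p) (d p)) = fun p =>
      a p • (1 : ℍ) + b p • quatI + c p • quatJ + d p • (quatI * quatJ) := by
    funext p
    ext <;> simp [Quaternion.re_mul, Quaternion.imI_mul, Quaternion.imJ_mul, Quaternion.imK_mul]
  rw [this]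
  fun_prop

/-- The quaternion `x + √(1 - x²) i`. -/
noncomputable def axisQuat (x : ℝ) : ℍ := quatMk x √(1 - x ^ 2) 0 0

/-- The cosine of the angle between the axes of `axisQuat x` and of the first factor. -/
noncomputable def tiltCos (α β x : ℝ) : ℝ :=
  (Real.cos β - x * Real.cos α) / (Real.sin α * √(1 - x ^ 2))

/-- The first factor of `axisQuat x`: a unit quaternion of angle `α`. -/
noncomputable def leftFactor (α β x : ℝ) : ℍ :=
  quatMk (Real.cos α) (Real.sin α * tiltCos α β x) (Real.sin α * √(1 - tiltCos α β x ^ 2)) 0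

/-- The second factor of `axisQuat x`: a unit quaternion of angle `β`. -/
noncomputable def rightFactor (α β x : ℝ) : ℍ := star (leftFactor α β x) * axisQuat x

/-- The unit quaternion of angle `γ` whose axis has height `1 - 2 u²` and azimuth `2 π q`. -/
noncomputable def sphereQuat (γ u q : ℝ) : ℍ :=
  quatMk (Real.cos γ) (Real.sin γ * (1 - 2 * u ^ 2))
    (Real.sin γ * (2 * u * √(1 - u ^ 2)) * Real.cos (2 * Real.pi * q))
    (Real.sin γ * (2 * u * √(1 - u ^ 2)) * Real.sin (2 * Real.pi * q))

theorem normSq_axisQuat {x : ℝ} (hx : x ^ 2 ≤ 1) : normSq (axisQuat x) = 1 := by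
  rw [axisQuat, normSq_quatMk]
  rw [Real.sq_sqrt (by linarith)]; ring

theorem normSq_sphereQuat {u : ℝ} (hu : u ^ 2 ≤ 1) (γ q : ℝ) : normSq (sphereQuat γ u q) = 1 := by
  rw [sphereQuat, normSq_quatMk]
  have h1 := Real.sq_sqrt (show 0 ≤ 1 - u ^ 2 by linarith)
  have h2 := Real.sin_sq_add_cos_sq (2 * Real.pi * q)
  have h3 := Real.sin_sq_add_cos_sq γ
  generalize √(1 - u ^ 2) = s at *
  linear_combination h3 + Real.sin γ ^ 2 * 4 * u ^ 2 * h1 +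
    Real.sin γ ^ 2 * 4 * u ^ 2 * s ^ 2 * h2

theorem sq_lt_one_of_mem {α β x : ℝ} (h₁ : -1 < Real.cos (α + β)) (h₂ : Real.cos (α - β) < 1)
    (hx : x ∈ Set.Icc (Real.cos (α + β)) (Real.cos (α - β))) : x ^ 2 < 1 := by
  have := hx.1; have := hx.2; nlinarith

theorem tiltCos_sq_le_one {α β x : ℝ} (hα : 0 < Real.sin α)
    (h₁ : -1 < Real.cos (α + β)) (h₂ : Real.cos (α - β) < 1)
    (hx : x ∈ Set.Icc (Real.cos (α + β)) (Real.cos (α - β))) : tiltCos α β x ^ 2 ≤ 1 := by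
  have hx1 := sq_lt_one_of_mem h₁ h₂ hx
  have hp : 0 < Real.sin α ^ 2 * (1 - x ^ 2) := mul_pos (pow_pos hα 2) (by linarith)
  rw [tiltCos, div_pow, mul_pow, Real.sq_sqrt (by linarith), div_le_one hp]
  have h := mul_nonneg (sub_nonneg.mpr hx.1) (sub_nonneg.mpr hx.2)
  rw [Real.cos_add, Real.cos_sub] at h
  nlinarith [Real.sin_sq_add_cos_sq α, Real.sin_sq_add_cos_sq β, h]

theorem normSq_leftFactor {α β x : ℝ} (h : tiltCos α β x ^ 2 ≤ 1) :
    normSq (leftFactor α β x) = 1 := by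
  rw [leftFactor, normSq_quatMk]
  have h1 := Real.sq_sqrt (show 0 ≤ 1 - tiltCos α β x ^ 2 by linarith)
  have h3 := Real.sin_sq_add_cos_sq α
  linear_combination h3 + Real.sin α ^ 2 * h1

theorem leftFactor_mul_rightFactor {α β x : ℝ} (h : tiltCos α β x ^ 2 ≤ 1) :
    leftFactor α β x * rightFactor α β x = axisQuat x := by
  rw [rightFactor, ← mul_assoc, self_mul_star, normSq_leftFactor h, coe_one, one_mul]

theorem normSq_rightFactor {α β x : ℝ} (h : tiltCos α β x ^ 2 ≤ 1) (hx : x ^ 2 ≤ 1) :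
    normSq (rightFactor α β x) = 1 := by
  rw [rightFactor, map_mul, normSq_star, normSq_leftFactor h, normSq_axisQuat hx, one_mul]

theorem re_rightFactor {α β x : ℝ} (hα : 0 < Real.sin α) (hx : x ^ 2 < 1) :
    (rightFactor α β x).re = Real.cos β := by
  have hs : 0 < √(1 - x ^ 2) := Real.sqrt_pos.mpr (by linarith)
  simp only [rightFactor, Quaternion.re_mul, re_star, imI_star, imJ_star, imK_star, leftFactor,
    axisQuat, quatMk_re, quatMk_imI, quatMk_imJ, quatMk_imK]
  rw [tiltCos]
  field_simp
  ring

theorem continuous_axisQuat : Continuous axisQuat := by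
  rw [← continuousOn_univ]
  unfold axisQuat
  exact continuousOn_quatMk (by fun_prop) (by fun_prop) (by fun_prop) (by fun_prop)

theorem continuousOn_leftFactor {α β : ℝ} (hα : 0 < Real.sin α)
    (h₁ : -1 < Real.cos (α + β)) (h₂ : Real.cos (α - β) < 1) :
    ContinuousOn (leftFactor α β) (Set.Icc (Real.cos (α + β)) (Real.cos (α - β))) := by
  have ht : ContinuousOn (tiltCos α β) (Set.Icc (Real.cos (α + β)) (Real.cos (α - β))) := by
    unfold tiltCos
    refine ContinuousOn.div (by fun_prop) (by fun_prop) fun x hx => ?_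
    have := sq_lt_one_of_mem h₁ h₂ hx
    exact (mul_pos hα (Real.sqrt_pos.mpr (by linarith))).ne'
  unfold leftFactor
  exact continuousOn_quatMk (by fun_prop) (by fun_prop) (by fun_prop) (by fun_prop)

theorem continuous_sphereQuat (γ : ℝ) : Continuous fun p : ℝ × ℝ => sphereQuat γ p.1 p.2 := by
  rw [← continuousOn_univ]
  unfold sphereQuat
  exact continuousOn_quatMk (by fun_prop) (by fun_prop) (by fun_prop) (by fun_prop)

theorem coe_exp_mul_I (θ : ℝ) :
    ((Complex.exp (θ * Complex.I) : ℂ) : ℍ) = quatMk (Real.cos θ) (Real.sin θ) 0 0 := by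
  ext <;> simp [Complex.exp_ofReal_mul_I_re, Complex.exp_ofReal_mul_I_im]

/-- At an extreme value of the parameter the two factors have the axis `i`. -/
theorem factors_of_cos_add {α β : ℝ} (hα : 0 < Real.sin α) (hs : Real.sin (α + β) ≠ 0) :
    ∃ ε : ℝ, (ε = 1 ∨ ε = -1) ∧
      leftFactor α β (Real.cos (α + β)) = ((Complex.exp ((ε * α : ℝ) * Complex.I) : ℂ) : ℍ) ∧
      rightFactor α β (Real.cos (α + β)) = ((Complex.exp ((ε * β : ℝ) * Complex.I) : ℂ) : ℍ) ∧
      axisQuat (Real.cos (α + β)) =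
        ((Complex.exp ((ε * (α + β) : ℝ) * Complex.I) : ℂ) : ℍ) := by
  obtain ⟨ε, hε, hε'⟩ : ∃ ε : ℝ, (ε = 1 ∨ ε = -1) ∧
      √(1 - Real.cos (α + β) ^ 2) = ε * Real.sin (α + β) := by
    rw [← Real.abs_sin_eq_sqrt_one_sub_cos_sq]
    rcases abs_choice (Real.sin (α + β)) with h | h
    · exact ⟨1, Or.inl rfl, by rw [h, one_mul]⟩
    · exact ⟨-1, Or.inr rfl, by rw [h, neg_one_mul]⟩
  have hε2 : ε * ε = 1 := by rcases hε with rfl | rfl <;> norm_num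
  have hε0 : ε ≠ 0 := by rintro rfl; simp at hε2
  have ht : tiltCos α β (Real.cos (α + β)) = ε := by
    rw [tiltCos, hε', div_eq_iff (mul_ne_zero hα.ne' (mul_ne_zero hε0 hs))]
    have h2 : Real.cos β = Real.cos (α + β) * Real.cos α + Real.sin (α + β) * Real.sin α := by
      rw [← Real.cos_sub]; ring_nf
    rw [h2]
    linear_combination (-Real.sin α * Real.sin (α + β)) * hε2
  have hcos : ∀ x : ℝ, Real.cos (ε * x) = Real.cos x := fun x => by
    rcases hε with rfl | rfl <;> simp
  have hsin : ∀ x : ℝ, Real.sin (ε * x) = ε * Real.sin x := fun x => by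
    rcases hε with rfl | rfl <;> simp
  have hl : leftFactor α β (Real.cos (α + β)) =
      ((Complex.exp ((ε * α : ℝ) * Complex.I) : ℂ) : ℍ) := by
    rw [leftFactor, ht, coe_exp_mul_I, hcos, hsin, pow_two, hε2, mul_comm ε]
    simp
  have hp : axisQuat (Real.cos (α + β)) =
      ((Complex.exp ((ε * (α + β) : ℝ) * Complex.I) : ℂ) : ℍ) := by
    rw [axisQuat, coe_exp_mul_I, hε', hcos, hsin]
  refine ⟨ε, hε, hl, ?_, hp⟩
  have h1 := leftFactor_mul_rightFactor (α := α) (β := β) (x := Real.cos (α + β))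
    (by rw [ht, pow_two, hε2])
  rw [hl, hp] at h1
  have h0 := coeComplex_ne_zero (Complex.exp_ne_zero (((ε * α : ℝ) : ℂ) * Complex.I))
  apply mul_left_cancel₀ h0
  rw [h1, ← coeComplex_mul, ← Complex.exp_add]
  congr 2
  push_cast
  ring

/-- The weights whose exponent sum counts a single generator. -/
def genWeight : Gen → Gen → ℤ
  | .u, .u => 1
  | .x, .x => 1
  | .y, .y => 1
  | .z, .z => 1
  | _, _ => 0

/-- The value of a word on commuting quaternions. -/
theorem wordVal_aligned {f : Gen → ℍ} {α β γ : ℝ} {w : FreeGroup Gen}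
    (hx : f .x = ((Complex.exp (α * Complex.I) : ℂ) : ℍ))
    (hy : f .y = ((Complex.exp (β * Complex.I) : ℂ) : ℍ))
    (hz : f .z = ((Complex.exp (γ * Complex.I) : ℂ) : ℍ))
    (hu : f .u = ((1 + Complex.exp ((α + β + γ : ℝ) * Complex.I) : ℂ) : ℍ)) (hu0 : f .u ≠ 0)
    (hodd : Odd (expSum (genWeight .u) w)) :
    ∃ μ : ℝ, 0 < μ ∧ (wordVal f w).im = (μ * (Real.cos ((α + β + γ) / 2) *
      Real.sin (((2 * expSum (genWeight .x) w + expSum (genWeight .u) w : ℤ) * α +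
        (2 * expSum (genWeight .y) w + expSum (genWeight .u) w : ℤ) * β +
        (2 * expSum (genWeight .z) w + expSum (genWeight .u) w : ℤ) * γ) / 2))) • quatI := by
  set s := expSum (genWeight .u) w
  set ψ : ℝ := α + β + γ with hψ
  set κ := Real.cos (ψ / 2) with hκ
  have hfac : 1 + Complex.exp ((ψ : ℝ) * Complex.I) =
      ((2 * κ : ℝ) : ℂ) * Complex.exp ((ψ / 2 : ℝ) * Complex.I) := by
    have h1 : Complex.exp ((ψ : ℝ) * Complex.I) =
        Complex.exp ((ψ / 2 : ℝ) * Complex.I) * Complex.exp ((ψ / 2 : ℝ) * Complex.I) := by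
      rw [← Complex.exp_add]; congr 1; push_cast; ring
    have h2 : (1 : ℂ) = Complex.exp ((ψ / 2 : ℝ) * Complex.I) *
        Complex.exp (-((ψ / 2 : ℝ) : ℂ) * Complex.I) := by
      rw [← Complex.exp_add]; simp
    have h3 : ((2 * κ : ℝ) : ℂ) = Complex.exp ((ψ / 2 : ℝ) * Complex.I) +
        Complex.exp (-((ψ / 2 : ℝ) : ℂ) * Complex.I) := by
      rw [hκ, Complex.ofReal_mul, Complex.ofReal_cos, Complex.ofReal_ofNat,
        Complex.two_cos]
    rw [h1, h3]; nth_rewrite 1 [h2]; ring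
  have hκ0 : κ ≠ 0 := by
    rintro h
    rw [hfac, h] at hu
    exact hu0 (by rw [hu]; simp)
  obtain ⟨δ, hδ, hδ'⟩ : ∃ δ : ℤ, ((2 * κ : ℝ) : ℂ) =
      Complex.exp ((Real.log |2 * κ| : ℝ) + (δ * Real.pi : ℝ) * Complex.I) ∧
      ∀ θ : ℝ, Real.sin (θ + s * (δ * Real.pi)) = (κ / |κ|) * Real.sin θ := by
    rcases lt_or_gt_of_ne hκ0 with h | h
    · refine ⟨1, ?_, fun θ => ?_⟩
      · rw [Complex.exp_add, ← Complex.ofReal_exp, Real.exp_log (by positivity),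
          Int.cast_one, one_mul, Complex.exp_pi_mul_I, abs_of_neg (by linarith)]
        push_cast; ring
      · rw [Int.cast_one, one_mul, Real.sin_add_int_mul_pi, hodd.neg_one_zpow, abs_of_neg h,
          div_neg, div_self hκ0]
    · refine ⟨0, ?_, fun θ => ?_⟩
      · rw [Complex.exp_add, ← Complex.ofReal_exp, Real.exp_log (by positivity),
          abs_of_pos (by linarith)]
        simp
      · rw [Int.cast_zero, zero_mul, mul_zero, add_zero, abs_of_pos h, div_self hκ0, one_mul]
  let c : Gen → ℂ := fun g => match g with
    | .u => ((Real.log |2 * κ| : ℝ) + (δ * Real.pi : ℝ) * Complex.I) + (ψ / 2 : ℝ) * Complex.I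
    | .x => α * Complex.I
    | .y => β * Complex.I
    | .z => γ * Complex.I
  have hval := wordVal_exp (f := f) (c := c) (v := genWeight)
    (by
      rintro (_ | _ | _ | _)
      · rw [hu, hfac, hδ, ← Complex.exp_add]
      · exact hx
      · exact hy
      · exact hz)
    (by rintro c (_ | _ | _ | _) <;> simp [genWeight]) w
  have hexp : (s * c .u + expSum (genWeight .x) w * c .x +
      expSum (genWeight .y) w * c .y + expSum (genWeight .z) w * c .z) =
      ((s * Real.log |2 * κ| : ℝ) : ℂ) +
      (((((2 * expSum (genWeight .x) w + s : ℤ) * α +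
        (2 * expSum (genWeight .y) w + s : ℤ) * β +
        (2 * expSum (genWeight .z) w + s : ℤ) * γ) / 2) + s * (δ * Real.pi) : ℝ) : ℂ) *
        Complex.I := by
    simp only [c, hψ]
    push_cast
    ring
  rw [hexp] at hval
  refine ⟨Real.exp (s * Real.log |2 * κ|) / |κ|, by positivity, ?_⟩
  rw [hval, Complex.exp_add, ← Complex.ofReal_exp]
  ext
  · simp
  · rw [imI_im, imI_coeComplex, Complex.im_ofReal_mul, Complex.exp_ofReal_mul_I_im, hδ',
      imI_smul, quatI_imI, smul_eq_mul]
    ring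
  · simp
  · simp

/-- The direction of the imaginary part of a quaternion. -/
noncomputable def imDir (q : ℍ) : ℍ := ‖q.im‖⁻¹ • q.im

theorem imDir_mul_self {q : ℍ} (h : q.im ≠ 0) : imDir q * imDir q = -1 := by
  have h1 : q.im * q.im = -((‖q.im‖ * ‖q.im‖ : ℝ) : ℍ) := by
    rw [← pow_two, im_sq, normSq_eq_norm_mul_self]
  have h2 : ‖q.im‖ ≠ 0 := norm_ne_zero_iff.mpr h
  rw [imDir, smul_mul_smul_comm, h1, smul_neg, smul_coe]
  field_simp
  simp

theorem imDir_neg (q : ℍ) : imDir (-q) = -imDir q := by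
  simp [imDir]

theorem im_conj {R : ℍ} (hR : R ≠ 0) (q : ℍ) : (R * q * R⁻¹).im = R * q.im * R⁻¹ := by
  have h1 : R * q * R⁻¹ = (q.re : ℍ) + R * q.im * R⁻¹ := by
    nth_rewrite 1 [← re_add_im q]
    rw [mul_add, add_mul, ← coe_commutes, mul_assoc, mul_inv_cancel₀ hR, mul_one]
  have h2 : (R * q.im * R⁻¹).re = 0 := by
    rw [← sq_eq_neg_normSq]
    have : (R * q.im * R⁻¹) ^ 2 = R * (q.im ^ 2) * R⁻¹ := by
      simp only [pow_two, mul_assoc, inv_mul_cancel_left₀ hR]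
    rw [this, im_sq, mul_neg, ← coe_commutes, neg_mul, mul_assoc, mul_inv_cancel₀ hR, mul_one,
      map_mul, map_mul, normSq_inv, mul_comm (normSq R), mul_assoc,
      mul_inv_cancel₀ (normSq_ne_zero.mpr hR), mul_one]
  rw [h1, im_add, im_coe, zero_add]
  conv_rhs => rw [← re_add_im (R * q.im * R⁻¹), h2, coe_zero, zero_add]

theorem imDir_conj {R : ℍ} (hR : R ≠ 0) (q : ℍ) :
    imDir (R * q * R⁻¹) * R = R * imDir q := by
  have hn : ‖R * q.im * R⁻¹‖ = ‖q.im‖ := by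
    rw [norm_mul, norm_mul, norm_inv, mul_comm ‖R‖, mul_assoc,
      mul_inv_cancel₀ (norm_ne_zero_iff.mpr hR), mul_one]
  rw [imDir, imDir, im_conj hR, hn, smul_mul_assoc, mul_assoc, inv_mul_cancel₀ hR, mul_one,
    mul_smul_comm]

theorem imDir_of_im_eq {q : ℍ} {μ T : ℝ} (hμ : 0 < μ) (h : q.im = (μ * T) • quatI) :
    imDir q = (T / |T|) • quatI := by
  have hn : ‖quatI‖ = 1 := norm_eq_one_of_mul_self quatI_mul_self
  rw [imDir, h, norm_smul, hn, mul_one, smul_smul, Real.norm_eq_abs, abs_mul, abs_of_pos hμ]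
  congr 1
  field_simp

theorem continuousOn_imDir {E : Type*} [TopologicalSpace E] {s : Set E} {f : E → ℍ}
    (hf : ContinuousOn f s) (h0 : ∀ p ∈ s, (f p).im ≠ 0) :
    ContinuousOn (fun p => imDir (f p)) s := by
  have h1 : ContinuousOn (fun p => (f p).im) s := continuous_im.comp_continuousOn hf
  exact (h1.norm.inv₀ fun p hp => norm_ne_zero_iff.mpr (h0 p hp)).smul h1

theorem sphereQuat_rotate (γ u q : ℝ) :
    sphereQuat γ u q * ((Complex.exp ((Real.pi * q : ℝ) * Complex.I) : ℂ) : ℍ) =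
      ((Complex.exp ((Real.pi * q : ℝ) * Complex.I) : ℂ) : ℍ) * sphereQuat γ u 0 := by
  rw [coe_exp_mul_I, sphereQuat, sphereQuat, mul_assoc 2 Real.pi q, Real.sin_two_mul,
    Real.cos_two_mul]
  have h := Real.sin_sq_add_cos_sq (Real.pi * q)
  generalize Real.sin (Real.pi * q) = a at *
  generalize Real.cos (Real.pi * q) = b at *
  ext <;> simp [Quaternion.re_mul, Quaternion.imI_mul, Quaternion.imJ_mul, Quaternion.imK_mul]
  · ring
  · ring
  · linear_combination (Real.sin γ * (2 * u * √(1 - u ^ 2)) * 2 * b) * h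
  · linear_combination (0 : ℝ) * h

/-- Height of a path from the bottom to the top of a rectangle and back. -/
noncomputable def capProfile (t : ℝ) : ℝ := min 1 (min (3 * t) (3 * (1 - t)))

theorem continuous_capProfile : Continuous capProfile := by unfold capProfile; fun_prop

theorem capProfile_mem {t : ℝ} (ht : t ∈ Set.Icc (0 : ℝ) 1) :
    capProfile t ∈ Set.Icc (0 : ℝ) 1 := by
  refine ⟨le_min zero_le_one (le_min ?_ ?_), min_le_left _ _⟩
  · linarith [ht.1]
  · linarith [ht.2]

theorem capProfile_zero : capProfile 0 = 0 := by norm_num [capProfile]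
theorem capProfile_one : capProfile 1 = 0 := by norm_num [capProfile]
theorem capProfile_mid {t : ℝ} (ht : t ∈ Set.Icc (1 / 3 : ℝ) (2 / 3)) : capProfile t = 1 :=
  min_eq_left (le_min (by linarith [ht.1]) (by linarith [ht.2]))
theorem capProfile_symm (t : ℝ) : capProfile (1 - t) = capProfile t := by
  rw [capProfile, capProfile, sub_sub_cancel, min_comm (3 * (1 - t))]

theorem cos_mul_cos_half {ε : ℝ} (hε : ε = 1 ∨ ε = -1) (x y : ℝ) :
    Real.cos ((ε * x + y) / 2) * Real.cos ((ε * x + -y) / 2) = (Real.cos x + Real.cos y) / 2 := by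
  rw [Real.cos_add_cos]
  rcases hε with rfl | rfl
  · rw [one_mul, ← sub_eq_add_neg]; ring
  · rw [show (-1 * x + y) / 2 = -((x - y) / 2) by ring,
      show (-1 * x + -y) / 2 = -((x + y) / 2) by ring, Real.cos_neg, Real.cos_neg]; ring

theorem sin_mul_sin_half {ε : ℝ} (hε : ε = 1 ∨ ε = -1) (x y : ℝ) :
    Real.sin ((ε * x + y) / 2) * Real.sin ((ε * x + -y) / 2) = (Real.cos y - Real.cos x) / 2 := by
  rw [Real.cos_sub_cos]
  rcases hε with rfl | rfl
  · rw [one_mul, ← sub_eq_add_neg, add_comm y x,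
      show (y - x) / 2 = -((x - y) / 2) by ring, Real.sin_neg]; ring
  · rw [show (-1 * x + y) / 2 = (y - x) / 2 by ring,
      show (-1 * x + -y) / 2 = -((y + x) / 2) by ring, Real.sin_neg]; ring

theorem cos_mem_Ioo_of_sin_ne_zero {θ : ℝ} (h : Real.sin θ ≠ 0) :
    -1 < Real.cos θ ∧ Real.cos θ < 1 := by
  have h1 := Real.sin_sq_add_cos_sq θ
  have h2 : 0 < Real.sin θ ^ 2 := by positivity
  constructor <;> nlinarith

/-- The assignment of quaternions to the generators in a family of representations. -/
noncomputable def genFamily (α β γ x u q : ℝ) (U : ℍ) : Gen → ℍ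
  | .u => U
  | .x => leftFactor α β x
  | .y => rightFactor α β x
  | .z => sphereQuat γ u q

theorem ne_zero_of_normSq_eq_one {q : ℍ} (h : normSq q = 1) : q ≠ 0 := by
  rintro rfl; simp at h

/-- The sign of a product of four trigonometric expressions is determined by a homotopy of
families of representations on which a word has no central value. -/
theorem trig_sign_of_family {α β γ : ℝ} (hα : 0 < Real.sin α)
    (hs₁ : Real.sin (α + β) ≠ 0) (hs₂ : Real.sin (α - β) ≠ 0) {w : FreeGroup Gen}
    (hw : ∀ f : Gen → ℍ, (∀ g, f g ≠ 0) → (∃ s : ℝ, f .u * f .u = s • (f .x * f .y * f .z)) →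
      (f .x).re = Real.cos α → normSq (f .x) = 1 → (f .y).re = Real.cos β → normSq (f .y) = 1 →
      (f .z).re = Real.cos γ → normSq (f .z) = 1 → (wordVal f w).im ≠ 0)
    (hodd : Odd (expSum (genWeight .u) w))
    (x : ℝ × ℝ → ℝ) (hx : Continuous x)
    (hxm : ∀ r ∈ Set.Icc (0 : ℝ) 1, ∀ t ∈ Set.Icc (0 : ℝ) 1,
      x (r, t) ∈ Set.Icc (Real.cos (α + β)) (Real.cos (α - β)))
    (hx₁ : ∀ t ∈ Set.Icc (0 : ℝ) (1 / 3), x (1, t) = Real.cos (α + β))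
    (hx₂ : ∀ t ∈ Set.Icc (2 / 3 : ℝ) 1, x (1, t) = Real.cos (α - β))
    (G : ℝ × ℝ × ℝ → ℍ) (hG : ContinuousOn G unitCube) (hG0 : ∀ p ∈ unitCube, G p ≠ 0)
    (hGsq : ∀ r ∈ Set.Icc (0 : ℝ) 1, ∀ t ∈ Set.Icc (0 : ℝ) 1, ∀ q ∈ Set.Icc (0 : ℝ) 1,
      ∃ s : ℝ, G (r, t, q) * G (r, t, q) =
        s • (axisQuat (x (r, t)) * sphereQuat γ (r * capProfile t) q))
    (hGper : ∀ r ∈ Set.Icc (0 : ℝ) 1, ∀ t ∈ Set.Icc (0 : ℝ) 1, G (r, t, 1) = G (r, t, 0))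
    (hGend : ∀ r ∈ Set.Icc (0 : ℝ) 1, ∀ q ∈ Set.Icc (0 : ℝ) 1,
      G (r, 0, q) = G (r, 0, 0) ∧ G (r, 1, q) = G (r, 1, 0))
    (hG1 : ∀ t ∈ Set.Icc (0 : ℝ) 1, ∀ q ∈ Set.Icc (0 : ℝ) 1,
      G (1, t, q) = 1 + axisQuat (x (1, t)) * sphereQuat γ (capProfile t) q)
    {A B C : ℤ} (hA : A = 2 * expSum (genWeight .x) w + expSum (genWeight .u) w)
    (hB : B = 2 * expSum (genWeight .y) w + expSum (genWeight .u) w)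
    (hC : C = 2 * expSum (genWeight .z) w + expSum (genWeight .u) w) :
    ((∀ t ∈ Set.Icc (0 : ℝ) 1, ∀ q ∈ Set.Icc (0 : ℝ) 1, G (0, t, q) = G (0, t, 0)) →
      0 < (Real.cos (α + β) + Real.cos γ) * (Real.cos (α - β) + Real.cos γ) *
        ((Real.cos (C * γ) - Real.cos (A * α + B * β)) *
          (Real.cos (C * γ) - Real.cos (A * α - B * β)))) ∧
    ((∀ t ∈ Set.Icc (0 : ℝ) 1, ∀ q ∈ Set.Icc (0 : ℝ) (1 / 2),
      x (0, 1 - t) = x (0, t) ∧ G (0, 1 - t, q + 1 / 2) = -G (0, t, q)) →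
      (Real.cos (α + β) + Real.cos γ) * (Real.cos (α - β) + Real.cos γ) *
        ((Real.cos (C * γ) - Real.cos (A * α + B * β)) *
          (Real.cos (C * γ) - Real.cos (A * α - B * β))) < 0) := by
  have z0 : (0 : ℝ) ∈ Set.Icc (0 : ℝ) 1 := ⟨le_rfl, zero_le_one⟩
  have z1 : (1 : ℝ) ∈ Set.Icc (0 : ℝ) 1 := ⟨zero_le_one, le_rfl⟩
  have z3 : (1 / 3 : ℝ) ∈ Set.Icc (0 : ℝ) 1 := by constructor <;> norm_num
  have z4 : (2 / 3 : ℝ) ∈ Set.Icc (0 : ℝ) 1 := by constructor <;> norm_num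
  have hmem : ∀ r ∈ Set.Icc (0 : ℝ) 1, ∀ t ∈ Set.Icc (0 : ℝ) 1, ∀ q ∈ Set.Icc (0 : ℝ) 1,
      (r, t, q) ∈ unitCube := fun r hr t ht q hq =>
    ⟨⟨hr.1, ht.1, hq.1⟩, ⟨hr.2, ht.2, hq.2⟩⟩
  have hmem' : ∀ p ∈ unitCube, p.1 ∈ Set.Icc (0 : ℝ) 1 ∧ p.2.1 ∈ Set.Icc (0 : ℝ) 1 ∧
      p.2.2 ∈ Set.Icc (0 : ℝ) 1 := fun p hp =>
    ⟨⟨hp.1.1, hp.2.1⟩, ⟨hp.1.2.1, hp.2.2.1⟩, ⟨hp.1.2.2, hp.2.2.2⟩⟩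
  have h₁ := (cos_mem_Ioo_of_sin_ne_zero hs₁).1
  have h₂ := (cos_mem_Ioo_of_sin_ne_zero hs₂).2
  let f : ℝ × ℝ × ℝ → Gen → ℍ := fun p =>
    genFamily α β γ (x (p.1, p.2.1)) (p.1 * capProfile p.2.1) p.2.2 (G p)
  -- properties of the family of representations
  have hnorm : ∀ p ∈ unitCube, normSq (f p .x) = 1 ∧ normSq (f p .y) = 1 ∧
      normSq (f p .z) = 1 := fun p hp => by
    obtain ⟨hr, ht, hq⟩ := hmem' p hp
    have hx' := hxm _ hr _ ht
    have ht1 := tiltCos_sq_le_one hα h₁ h₂ hx'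
    have hx1 := sq_lt_one_of_mem h₁ h₂ hx'
    refine ⟨normSq_leftFactor ht1, normSq_rightFactor ht1 hx1.le, normSq_sphereQuat ?_ _ _⟩
    have hc := capProfile_mem ht
    exact pow_le_one₀ (mul_nonneg hr.1 hc.1) (mul_le_one₀ hr.2 hc.1 hc.2)
  have hf0 : ∀ p ∈ unitCube, ∀ g, f p g ≠ 0 := by
    rintro p hp (_ | _ | _ | _)
    · exact hG0 p hp
    · exact ne_zero_of_normSq_eq_one (hnorm p hp).1
    · exact ne_zero_of_normSq_eq_one (hnorm p hp).2.1
    · exact ne_zero_of_normSq_eq_one (hnorm p hp).2.2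
  have hxy : ∀ p ∈ unitCube, f p .x * f p .y = axisQuat (x (p.1, p.2.1)) := fun p hp => by
    obtain ⟨hr, ht, hq⟩ := hmem' p hp
    exact leftFactor_mul_rightFactor (tiltCos_sq_le_one hα h₁ h₂ (hxm _ hr _ ht))
  have hfim : ∀ p ∈ unitCube, (wordVal (f p) w).im ≠ 0 := fun p hp => by
    obtain ⟨hr, ht, hq⟩ := hmem' p hp
    refine hw (f p) (hf0 p hp) ?_ rfl (hnorm p hp).1
      (re_rightFactor hα (sq_lt_one_of_mem h₁ h₂ (hxm _ hr _ ht))) (hnorm p hp).2.1 rfl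
      (hnorm p hp).2.2
    rw [hxy p hp]
    exact hGsq _ hr _ ht _ hq
  have hfc : ∀ g, ContinuousOn (fun p => f p g) unitCube := by
    have hL : ContinuousOn (fun p : ℝ × ℝ × ℝ => leftFactor α β (x (p.1, p.2.1))) unitCube :=
      (continuousOn_leftFactor hα h₁ h₂).comp (hx.comp (by fun_prop)).continuousOn
        fun p hp => hxm _ (hmem' p hp).1 _ (hmem' p hp).2.1
    rintro (_ | _ | _ | _)
    · exact hG
    · exact hL
    · exact (continuous_star.comp_continuousOn hL).mul
        (continuous_axisQuat.comp (hx.comp (by fun_prop))).continuousOn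
    · have := continuous_capProfile
      exact ((continuous_sphereQuat γ).comp (f := fun p : ℝ × ℝ × ℝ =>
        (p.1 * capProfile p.2.1, p.2.2)) (by fun_prop)).continuousOn
  let F : ℝ × ℝ × ℝ → ℍ := fun p => imDir (wordVal (f p) w)
  have hF : ContinuousOn F unitCube :=
    continuousOn_imDir (continuousOn_wordVal hfc hf0 w) hfim
  have hsphere0 : ∀ q, sphereQuat γ 0 q = sphereQuat γ 0 0 := fun q => by simp [sphereQuat]
  have hsphere1 : ∀ q, sphereQuat γ 1 q = sphereQuat γ 1 0 := fun q => by simp [sphereQuat]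
  have hsphereper : ∀ u, sphereQuat γ u 1 = sphereQuat γ u 0 := fun u => by simp [sphereQuat]
  have hFeq : ∀ r t q q', sphereQuat γ (r * capProfile t) q = sphereQuat γ (r * capProfile t) q' →
      G (r, t, q) = G (r, t, q') → F (r, t, q) = F (r, t, q') := fun r t q q' h h' => by
    have hf : f (r, t, q) = f (r, t, q') := by
      funext g
      rcases g with _ | _ | _ | _
      · exact h'
      · rfl
      · rfl
      · exact h
    simp only [F, hf]
  have hcap : ∀ t ∈ Set.Icc (0 : ℝ) (1 / 3) ∪ Set.Icc (2 / 3) 1, ∀ q ∈ Set.Icc (0 : ℝ) 1,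
      F (1, t, q) * ((Complex.exp ((Real.pi * q : ℝ) * Complex.I) : ℂ) : ℍ) =
        ((Complex.exp ((Real.pi * q : ℝ) * Complex.I) : ℂ) : ℍ) * F (1, t, 0) := by
    intro t ht q hq
    have htm : t ∈ Set.Icc (0 : ℝ) 1 := by
      rcases ht with ht | ht
      · exact ⟨ht.1, ht.2.trans z3.2⟩
      · exact ⟨z4.1.trans ht.1, ht.2⟩
    obtain ⟨a, b, c, ha, hb, hc⟩ : ∃ a b c : ℂ, leftFactor α β (x (1, t)) = (a : ℍ) ∧
        rightFactor α β (x (1, t)) = (b : ℍ) ∧ axisQuat (x (1, t)) = (c : ℍ) := by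
      rcases ht with ht | ht
      · obtain ⟨ε, -, e1, e2, e3⟩ := factors_of_cos_add hα hs₁
        rw [hx₁ t ht]
        exact ⟨_, _, _, e1, e2, e3⟩
      · obtain ⟨ε, -, e1, e2, e3⟩ := factors_of_cos_add (β := -β) hα hs₂
        rw [← sub_eq_add_neg] at e1 e2 e3
        rw [hx₂ t ht]
        have hneg : tiltCos α (-β) = tiltCos α β := by
          funext y; rw [tiltCos, tiltCos, Real.cos_neg]
        rw [rightFactor, leftFactor, hneg] at e2
        rw [leftFactor, hneg] at e1
        exact ⟨_, _, _, e1, e2, e3⟩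
    set R : ℍ := ((Complex.exp ((Real.pi * q : ℝ) * Complex.I) : ℂ) : ℍ) with hR
    have hR0 : R ≠ 0 := coeComplex_ne_zero (Complex.exp_ne_zero _)
    have hZ : sphereQuat γ (1 * capProfile t) q = R * sphereQuat γ (1 * capProfile t) 0 * R⁻¹ := by
      rw [eq_mul_inv_iff_mul_eq₀ hR0]
      exact sphereQuat_rotate _ _ _
    have hfam : f (1, t, q) = fun g => R * f (1, t, 0) g * R⁻¹ := by
      funext g
      rw [eq_mul_inv_iff_mul_eq₀ hR0]
      rcases g with _ | _ | _ | _
      · change G (1, t, q) * R = R * G (1, t, 0)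
        rw [one_mul] at hZ
        rw [hG1 t htm q hq, hG1 t htm 0 z0, hZ, add_mul, mul_add, one_mul, mul_one, hc,
          mul_assoc, mul_assoc (R * _), inv_mul_cancel₀ hR0, mul_one, ← mul_assoc, ← mul_assoc,
          hR, coeComplex_comm c]
      · change leftFactor α β (x (1, t)) * R = R * leftFactor α β (x (1, t))
        rw [ha, hR, coeComplex_comm]
      · change rightFactor α β (x (1, t)) * R = R * rightFactor α β (x (1, t))
        rw [hb, hR, coeComplex_comm]
      · exact sphereQuat_rotate _ _ _
    simp only [F]
    rw [hfam, wordVal_conj (hf0 _ (hmem 1 z1 t htm 0 z0)) hR0, imDir_conj hR0]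
  -- the four poles
  let T : ℝ → ℝ → ℝ → ℝ := fun a b c =>
    Real.cos ((a + b + c) / 2) * Real.sin ((A * a + B * b + C * c) / 2)
  have hpole : ∀ t ∈ Set.Icc (0 : ℝ) 1, ∀ a b c : ℝ,
      leftFactor α β (x (1, t)) = ((Complex.exp (a * Complex.I) : ℂ) : ℍ) →
      rightFactor α β (x (1, t)) = ((Complex.exp (b * Complex.I) : ℂ) : ℍ) →
      sphereQuat γ (1 * capProfile t) 0 = ((Complex.exp (c * Complex.I) : ℂ) : ℍ) →
      T a b c ≠ 0 ∧ F (1, t, 0) = (T a b c / |T a b c|) • quatI := by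
    intro t ht a b c ea eb ec
    have hp := hmem 1 z1 t ht 0 z0
    obtain ⟨μ, hμ, him⟩ := wordVal_aligned (f := f (1, t, 0)) (w := w) ea eb ec
      (by
        change G (1, t, 0) = _
        rw [hG1 t ht 0 z0, ← one_mul (capProfile t), ec, ← hxy _ hp]
        change 1 + leftFactor α β (x (1, t)) * rightFactor α β (x (1, t)) * _ = _
        rw [ea, eb, ← coeComplex_mul, ← coeComplex_mul, ← Complex.exp_add, ← Complex.exp_add,
          coeComplex_add, coeComplex_one]
        congr 3
        push_cast
        ring)
      (hf0 _ hp .u) hodd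
    rw [← hA, ← hB, ← hC] at him
    refine ⟨fun h0 => hfim _ hp ?_, imDir_of_im_eq hμ him⟩
    rw [him]
    change (μ * T a b c) • quatI = 0
    rw [h0, mul_zero, zero_smul]
  have hz0 : sphereQuat γ (1 * 0) 0 = ((Complex.exp (γ * Complex.I) : ℂ) : ℍ) := by
    rw [coe_exp_mul_I, sphereQuat]; simp
  have hz1 : sphereQuat γ (1 * 1) 0 = ((Complex.exp ((-γ : ℝ) * Complex.I) : ℂ) : ℍ) := by
    rw [coe_exp_mul_I, sphereQuat]; norm_num
  obtain ⟨ε, hε, e1, e2, -⟩ := factors_of_cos_add hα hs₁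
  obtain ⟨ε', hε', e1', e2', -⟩ := factors_of_cos_add (β := -β) hα hs₂
  have hneg : tiltCos α (-β) = tiltCos α β := by
    funext y; rw [tiltCos, tiltCos, Real.cos_neg]
  rw [← sub_eq_add_neg] at e1' e2'
  rw [rightFactor, leftFactor, hneg] at e2'
  rw [leftFactor, hneg] at e1'
  have p0 := hpole 0 z0 (ε * α) (ε * β) γ
    (by rw [hx₁ 0 ⟨le_rfl, by norm_num⟩]; exact e1)
    (by rw [hx₁ 0 ⟨le_rfl, by norm_num⟩]; exact e2) (by rw [capProfile_zero]; exact hz0)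
  have p1 := hpole (1 / 3) z3 (ε * α) (ε * β) (-γ)
    (by rw [hx₁ (1 / 3) ⟨by norm_num, le_rfl⟩]; exact e1)
    (by rw [hx₁ (1 / 3) ⟨by norm_num, le_rfl⟩]; exact e2)
    (by rw [capProfile_mid ⟨le_rfl, by norm_num⟩]; exact hz1)
  have p2 := hpole (2 / 3) z4 (ε' * α) (ε' * -β) (-γ)
    (by rw [hx₂ (2 / 3) ⟨le_rfl, by norm_num⟩]; exact e1')
    (by rw [hx₂ (2 / 3) ⟨le_rfl, by norm_num⟩]; exact e2')
    (by rw [capProfile_mid ⟨by norm_num, le_rfl⟩]; exact hz1)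
  have p3 := hpole 1 z1 (ε' * α) (ε' * -β) γ
    (by rw [hx₂ 1 ⟨by norm_num, le_rfl⟩]; exact e1')
    (by rw [hx₂ 1 ⟨by norm_num, le_rfl⟩]; exact e2') (by rw [capProfile_one]; exact hz0)
  have hsign : ∀ y : ℝ, y ≠ 0 → y / |y| = 1 ∨ y / |y| = -1 := fun y hy => by
    rcases lt_or_gt_of_ne hy with h | h
    · right; rw [abs_of_neg h, div_neg, div_self hy]
    · left; rw [abs_of_pos h, div_self hy]
  have hmain := prod_signs_of_sphere_homotopy F hF
    (fun p hp => imDir_mul_self (hfim p hp))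
    (fun r hr t ht => hFeq r t 1 0 (hsphereper _) (hGper r hr t ht))
    (fun r hr q hq => hFeq r 0 q 0 (by rw [capProfile_zero, mul_zero, hsphere0])
      (hGend r hr q hq).1)
    (fun r hr q hq => hFeq r 1 q 0 (by rw [capProfile_one, mul_zero, hsphere0])
      (hGend r hr q hq).2)
    hcap
    (fun t ht q hq => by
      have htm : t ∈ Set.Icc (0 : ℝ) 1 := ⟨z3.1.trans ht.1, ht.2.trans z4.2⟩
      refine hFeq 1 t q 0 (by rw [capProfile_mid ht, mul_one, hsphere1]) ?_
      rw [hG1 t htm q hq, hG1 t htm 0 z0, capProfile_mid ht, hsphere1])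
    (hsign _ p0.1) (hsign _ p1.1) (hsign _ p2.1) (hsign _ p3.1) p0.2 p1.2 p2.2 p3.2
  have q1 : T (ε * α) (ε * β) γ * T (ε * α) (ε * β) (-γ) =
      (Real.cos (α + β) + Real.cos γ) / 2 *
        ((Real.cos (C * γ) - Real.cos (A * α + B * β)) / 2) := by
    rw [← cos_mul_cos_half hε, ← sin_mul_sin_half hε]
    simp only [T]
    ring_nf
  have q2 : T (ε' * α) (ε' * -β) (-γ) * T (ε' * α) (ε' * -β) γ =
      (Real.cos (α - β) + Real.cos γ) / 2 *
        ((Real.cos (C * γ) - Real.cos (A * α - B * β)) / 2) := by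
    rw [← cos_mul_cos_half hε', ← sin_mul_sin_half hε']
    simp only [T]
    ring_nf
  set T₀ := T (ε * α) (ε * β) γ
  set T₁ := T (ε * α) (ε * β) (-γ)
  set T₂ := T (ε' * α) (ε' * -β) (-γ)
  set T₃ := T (ε' * α) (ε' * -β) γ
  have hprod : (Real.cos (α + β) + Real.cos γ) * (Real.cos (α - β) + Real.cos γ) *
        ((Real.cos (C * γ) - Real.cos (A * α + B * β)) *
          (Real.cos (C * γ) - Real.cos (A * α - B * β))) = 16 * ((T₀ * T₁) * (T₂ * T₃)) := by
    rw [q1, q2]; ring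
  have habs : (T₀ * T₁) * (T₂ * T₃) = (T₀ / |T₀| * (T₁ / |T₁|) * (T₂ / |T₂| * (T₃ / |T₃|))) *
      (|T₀| * |T₁| * |T₂| * |T₃|) := by
    have a0 := abs_ne_zero.mpr p0.1
    have a1 := abs_ne_zero.mpr p1.1
    have a2 := abs_ne_zero.mpr p2.1
    have a3 := abs_ne_zero.mpr p3.1
    field_simp
  have hpos : 0 < |T₀| * |T₁| * |T₂| * |T₃| := by
    have a0 := abs_pos.mpr p0.1
    have a1 := abs_pos.mpr p1.1
    have a2 := abs_pos.mpr p2.1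
    have a3 := abs_pos.mpr p3.1
    positivity
  rw [hprod, habs]
  constructor
  · intro hconst
    rw [hmain.1 fun t ht q hq => hFeq 0 t q 0 (by rw [zero_mul, hsphere0]) (hconst t ht q hq)]
    linarith
  · intro hanti
    rw [hmain.2 ?_]
    · linarith
    · intro t ht q hq
      obtain ⟨ex, eG⟩ := hanti t ht q hq
      have hq' : q ∈ Set.Icc (0 : ℝ) 1 := ⟨hq.1, hq.2.trans (by norm_num)⟩
      have hsg := wordVal_sign (f := f (0, t, q)) (f' := f (0, 1 - t, q + 1 / 2))
        (hf0 _ (hmem 0 z0 t ht q hq')) (v := genWeight .u) (by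
          rintro (_ | _ | _ | _)
          · simp only [f, genFamily, genWeight, eG, zpow_one, neg_one_mul]
          · simp [f, genFamily, genWeight, ex]
          · simp [f, genFamily, genWeight, ex]
          · simp only [f, genFamily, genWeight, zero_mul, zpow_zero, one_mul]
            rw [hsphere0, hsphere0 q]) w
      rw [hodd.neg_one_zpow, neg_one_mul] at hsg
      simp only [F]
      rw [hsg, imDir_neg]

/-- Horizontal coordinate of a path along the left, upper and right sides of a rectangle. -/
noncomputable def slideProfile (t : ℝ) : ℝ := max (-1) (min 1 (6 * t - 3))

theorem continuous_slideProfile : Continuous slideProfile := by unfold slideProfile; fun_prop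

theorem slideProfile_mem (t : ℝ) : slideProfile t ∈ Set.Icc (-1 : ℝ) 1 :=
  ⟨le_max_left _ _, max_le (by norm_num) (min_le_left _ _)⟩

theorem slideProfile_left {t : ℝ} (ht : t ≤ 1 / 3) : slideProfile t = -1 := by
  rw [slideProfile, min_eq_right (by linarith), max_eq_left (by linarith)]

theorem slideProfile_right {t : ℝ} (ht : 2 / 3 ≤ t) : slideProfile t = 1 := by
  rw [slideProfile, min_eq_left (by linarith), max_eq_right (by norm_num)]

theorem slideProfile_symm (t : ℝ) : slideProfile (1 - t) = -slideProfile t := by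
  rw [slideProfile, slideProfile, ← min_neg_neg, ← max_neg_neg, neg_neg,
    max_min_distrib_left, max_eq_right (by norm_num : (-1 : ℝ) ≤ 1)]
  congr 2; ring

theorem capProfile_of_slideProfile_eq_zero {t : ℝ} (h : slideProfile t = 0) :
    capProfile t = 1 := by
  apply capProfile_mid
  constructor
  · by_contra hc
    rw [slideProfile_left (not_le.mp hc).le] at h
    norm_num at h
  · by_contra hc
    rw [slideProfile_right (not_le.mp hc).le] at h
    norm_num at h

theorem one_add_mul_self {p : ℍ} (h : normSq p = 1) :
    (1 + p) * (1 + p) = (2 + 2 * p.re) • p := by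
  have h1 : p * p = (2 * p.re) • p - 1 := by
    have h2 := self_mul_star p
    rw [h, coe_one, star_eq_two_re_sub, mul_sub, mul_coe_eq_smul] at h2
    rw [← h2]; abel
  have h2 : (1 + p) * (1 + p) = 1 + p + p + p * p := by
    rw [mul_add, mul_one, add_mul, one_mul, add_assoc (1 + p)]
  rw [h2, h1, add_smul, two_smul]
  abel

theorem sphereQuat_zero (γ q : ℝ) :
    sphereQuat γ 0 q = quatMk (Real.cos γ) (Real.sin γ) 0 0 := by simp [sphereQuat]

theorem sphereQuat_one_eq (γ u : ℝ) : sphereQuat γ u 1 = sphereQuat γ u 0 := by simp [sphereQuat]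

theorem normSq_axisQuat_mul_sphereQuat {x u : ℝ} (hx : x ^ 2 ≤ 1) (hu : u ^ 2 ≤ 1) (γ q : ℝ) :
    normSq (axisQuat x * sphereQuat γ u q) = 1 := by
  rw [map_mul, normSq_axisQuat hx, normSq_sphereQuat hu, one_mul]

theorem one_add_axisQuat_mul_sphereQuat {x : ℝ} (hx : x ^ 2 ≤ 1) (γ u q : ℝ) :
    1 + axisQuat x * sphereQuat γ u q =
      axisQuat x * (star (axisQuat x) + sphereQuat γ u q) := by
  rw [mul_add, self_mul_star, normSq_axisQuat hx, coe_one]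

theorem mul_capProfile_sq_le_one {r t : ℝ} (hr : r ∈ Set.Icc (0 : ℝ) 1)
    (ht : t ∈ Set.Icc (0 : ℝ) 1) : (r * capProfile t) ^ 2 ≤ 1 := by
  have hc := capProfile_mem ht
  exact pow_le_one₀ (mul_nonneg hr.1 hc.1) (mul_le_one₀ hr.2 hc.1 hc.2)

theorem unitCube_mem {p : ℝ × ℝ × ℝ} (hp : p ∈ unitCube) : p.1 ∈ Set.Icc (0 : ℝ) 1 ∧
    p.2.1 ∈ Set.Icc (0 : ℝ) 1 ∧ p.2.2 ∈ Set.Icc (0 : ℝ) 1 :=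
  ⟨⟨hp.1.1, hp.2.1⟩, ⟨hp.1.2.1, hp.2.2.1⟩, ⟨hp.1.2.2, hp.2.2.2⟩⟩

/-- The case in which the product of the three rotations is never `-1`. -/
theorem trig_sign_of_regular {α β γ : ℝ} (hα : 0 < Real.sin α)
    (hs₁ : Real.sin (α + β) ≠ 0) (hs₂ : Real.sin (α - β) ≠ 0)
    (hlt : Real.cos (α + β) < Real.cos (α - β)) {w : FreeGroup Gen}
    (hw : ∀ f : Gen → ℍ, (∀ g, f g ≠ 0) → (∃ s : ℝ, f .u * f .u = s • (f .x * f .y * f .z)) →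
      (f .x).re = Real.cos α → normSq (f .x) = 1 → (f .y).re = Real.cos β → normSq (f .y) = 1 →
      (f .z).re = Real.cos γ → normSq (f .z) = 1 → (wordVal f w).im ≠ 0)
    (hodd : Odd (expSum (genWeight .u) w))
    {A B C : ℤ} (hA : A = 2 * expSum (genWeight .x) w + expSum (genWeight .u) w)
    (hB : B = 2 * expSum (genWeight .y) w + expSum (genWeight .u) w)
    (hC : C = 2 * expSum (genWeight .z) w + expSum (genWeight .u) w)
    (hreg : 0 < (Real.cos (α + β) + Real.cos γ) * (Real.cos (α - β) + Real.cos γ)) :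
    0 < (Real.cos (α + β) + Real.cos γ) * (Real.cos (α - β) + Real.cos γ) *
        ((Real.cos (C * γ) - Real.cos (A * α + B * β)) *
          (Real.cos (C * γ) - Real.cos (A * α - B * β))) := by
  set a := Real.cos (α + β) with ha
  set b := Real.cos (α - β) with hb
  let x : ℝ × ℝ → ℝ := fun p => (a + b) / 2 + p.1 * ((b - a) / 2 * slideProfile p.2)
  have hslide := continuous_slideProfile
  have hcapc := continuous_capProfile
  have hx : Continuous x := by fun_prop
  have hxm : ∀ r ∈ Set.Icc (0 : ℝ) 1, ∀ t ∈ Set.Icc (0 : ℝ) 1, x (r, t) ∈ Set.Icc a b := by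
    intro r hr t _
    have h1 := slideProfile_mem t
    have h2 : |r * slideProfile t| ≤ 1 := by
      rw [abs_mul]
      exact mul_le_one₀ (abs_le.mpr ⟨by linarith [hr.1], hr.2⟩) (abs_nonneg _) (abs_le.mpr h1)
    have h3 := abs_le.mp h2
    have h4 : x (r, t) = (a + b) / 2 + (b - a) / 2 * (r * slideProfile t) := by
      simp only [x]; ring
    rw [h4]
    constructor <;> nlinarith [h3.1, h3.2]
  have hx1 : ∀ r ∈ Set.Icc (0 : ℝ) 1, ∀ t ∈ Set.Icc (0 : ℝ) 1, x (r, t) ^ 2 < 1 :=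
    fun r hr t ht => sq_lt_one_of_mem (cos_mem_Ioo_of_sin_ne_zero hs₁).1
      (cos_mem_Ioo_of_sin_ne_zero hs₂).2 (hxm r hr t ht)
  refine (trig_sign_of_family hα hs₁ hs₂ hw hodd x hx hxm (fun t ht => ?_) (fun t ht => ?_)
    (fun p => 1 + axisQuat (x (p.1, p.2.1)) * sphereQuat γ (p.1 * capProfile p.2.1) p.2.2)
    ?_ (fun p hp => ?_) (fun r hr t ht q hq => ?_) (fun r hr t ht => ?_) (fun r hr q hq => ?_)
    (fun t ht q hq => ?_) hA hB hC).1 (fun t ht q hq => ?_)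
  · simp only [x]; rw [slideProfile_left ht.2]; ring
  · simp only [x]; rw [slideProfile_right ht.1]; ring
  · exact (continuous_const.add ((continuous_axisQuat.comp (hx.comp (by fun_prop))).mul
      ((continuous_sphereQuat γ).comp (f := fun p : ℝ × ℝ × ℝ =>
        (p.1 * capProfile p.2.1, p.2.2)) (by fun_prop)))).continuousOn
  · obtain ⟨hr, ht, hq⟩ := unitCube_mem hp
    have h1 := (hx1 _ hr _ ht).le
    have h2 := hxm _ hr _ ht
    rw [one_add_axisQuat_mul_sphereQuat h1]
    refine mul_ne_zero (ne_zero_of_normSq_eq_one (normSq_axisQuat h1)) fun h => ?_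
    have h3 : x (p.1, p.2.1) + Real.cos γ = 0 := by
      have h4 := congrArg QuaternionAlgebra.re h
      simpa [axisQuat, sphereQuat] using h4
    rw [eq_neg_of_add_eq_zero_right h3] at hreg
    have h4 := mul_nonneg (sub_nonneg.mpr h2.1) (sub_nonneg.mpr h2.2)
    generalize x (p.1, p.2.1) = y at h4 hreg
    linarith
  · exact ⟨_, one_add_mul_self (normSq_axisQuat_mul_sphereQuat (hx1 r hr t ht).le
      (mul_capProfile_sq_le_one hr ht) _ _)⟩
  · simp only [sphereQuat_one_eq]
  · simp only [capProfile_zero, capProfile_one, mul_zero, sphereQuat_zero, and_self]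
  · simp only [one_mul]
  · simp only [zero_mul, sphereQuat_zero]

/-- The case in which the product of the three rotations takes the value `-1`. -/
theorem trig_sign_of_singular {α β γ : ℝ} (hα : 0 < Real.sin α) (hγ : 0 < Real.sin γ)
    (hs₁ : Real.sin (α + β) ≠ 0) (hs₂ : Real.sin (α - β) ≠ 0) {w : FreeGroup Gen}
    (hw : ∀ f : Gen → ℍ, (∀ g, f g ≠ 0) → (∃ s : ℝ, f .u * f .u = s • (f .x * f .y * f .z)) →
      (f .x).re = Real.cos α → normSq (f .x) = 1 → (f .y).re = Real.cos β → normSq (f .y) = 1 →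
      (f .z).re = Real.cos γ → normSq (f .z) = 1 → (wordVal f w).im ≠ 0)
    (hodd : Odd (expSum (genWeight .u) w))
    {A B C : ℤ} (hA : A = 2 * expSum (genWeight .x) w + expSum (genWeight .u) w)
    (hB : B = 2 * expSum (genWeight .y) w + expSum (genWeight .u) w)
    (hC : C = 2 * expSum (genWeight .z) w + expSum (genWeight .u) w)
    (h₁ : Real.cos (α + β) < -Real.cos γ) (h₂ : -Real.cos γ < Real.cos (α - β)) :
    (Real.cos (α + β) + Real.cos γ) * (Real.cos (α - β) + Real.cos γ) *
        ((Real.cos (C * γ) - Real.cos (A * α + B * β)) *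
          (Real.cos (C * γ) - Real.cos (A * α - B * β))) < 0 := by
  set a := Real.cos (α + β) + Real.cos γ with ha
  set b := Real.cos (α - β) + Real.cos γ with hb
  have ha0 : a < 0 := by linarith
  have hb0 : 0 < b := by linarith
  obtain ⟨h, hh0, hha, hhb⟩ : ∃ h : ℝ, 0 < h ∧ h ≤ -a ∧ h ≤ b :=
    ⟨min (-a) b, lt_min (by linarith) hb0, min_le_left _ _, min_le_right _ _⟩
  let e : ℝ × ℝ → ℝ := fun p => (1 - p.1) * (h * slideProfile p.2) +
    p.1 * (b * max (slideProfile p.2) 0 - a * min (slideProfile p.2) 0)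
  let x : ℝ × ℝ → ℝ := fun p => -Real.cos γ + p.1 * e p
  have hslide := continuous_slideProfile
  have hcapc := continuous_capProfile
  have he : Continuous e := by fun_prop
  have hx : Continuous x := by fun_prop
  have hpos : ∀ r t : ℝ, 0 ≤ slideProfile t →
      e (r, t) = slideProfile t * ((1 - r) * h + r * b) := fun r t ht => by
    simp only [e]; rw [max_eq_left ht, min_eq_right ht]; ring
  have hneg : ∀ r t : ℝ, slideProfile t ≤ 0 →
      e (r, t) = slideProfile t * ((1 - r) * h + r * -a) := fun r t ht => by
    simp only [e]; rw [max_eq_right ht, min_eq_left ht]; ring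
  have hcoef : ∀ r ∈ Set.Icc (0 : ℝ) 1, ∀ c : ℝ, h ≤ c →
      0 < (1 - r) * h + r * c ∧ (1 - r) * h + r * c ≤ c := fun r hr c hc => by
    have h1 := mul_nonneg hr.1 (sub_nonneg.mpr hc)
    have h2 := mul_nonneg (sub_nonneg.mpr hr.2) (sub_nonneg.mpr hc)
    constructor <;> nlinarith
  have hemem : ∀ r ∈ Set.Icc (0 : ℝ) 1, ∀ t, r * e (r, t) ∈ Set.Icc a b := by
    intro r hr t
    have hm := slideProfile_mem t
    rcases le_total 0 (slideProfile t) with hs | hs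
    · obtain ⟨c1, c2⟩ := hcoef r hr b hhb
      rw [hpos r t hs]
      have h1 : slideProfile t * ((1 - r) * h + r * b) ≤ 1 * b :=
        mul_le_mul hm.2 c2 c1.le zero_le_one
      have h0 : 0 ≤ slideProfile t * ((1 - r) * h + r * b) := mul_nonneg hs c1.le
      constructor
      · linarith [mul_nonneg hr.1 h0]
      · linarith [mul_le_mul hr.2 h1 h0 zero_le_one]
    · obtain ⟨c1, c2⟩ := hcoef r hr (-a) hha
      rw [hneg r t hs]
      have h1 : -slideProfile t * ((1 - r) * h + r * -a) ≤ 1 * -a :=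
        mul_le_mul (by linarith [hm.1]) c2 c1.le zero_le_one
      have h0 : 0 ≤ -slideProfile t * ((1 - r) * h + r * -a) := mul_nonneg (by linarith) c1.le
      constructor
      · linarith [mul_le_mul hr.2 h1 h0 zero_le_one]
      · linarith [mul_nonneg hr.1 h0]
  have he0 : ∀ r ∈ Set.Icc (0 : ℝ) 1, ∀ t, e (r, t) = 0 → slideProfile t = 0 := by
    intro r hr t h0
    rcases le_total 0 (slideProfile t) with hs | hs
    · rw [hpos r t hs] at h0
      exact (mul_eq_zero.mp h0).resolve_right (hcoef r hr b hhb).1.ne'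
    · rw [hneg r t hs] at h0
      exact (mul_eq_zero.mp h0).resolve_right (hcoef r hr (-a) hha).1.ne'
  have hxm : ∀ r ∈ Set.Icc (0 : ℝ) 1, ∀ t ∈ Set.Icc (0 : ℝ) 1,
      x (r, t) ∈ Set.Icc (Real.cos (α + β)) (Real.cos (α - β)) := by
    intro r hr t _
    have h1 := hemem r hr t
    simp only [x]
    constructor
    · linarith [h1.1]
    · linarith [h1.2]
  have hx1 : ∀ r ∈ Set.Icc (0 : ℝ) 1, ∀ t ∈ Set.Icc (0 : ℝ) 1, x (r, t) ^ 2 < 1 :=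
    fun r hr t ht => sq_lt_one_of_mem (cos_mem_Ioo_of_sin_ne_zero hs₁).1
      (cos_mem_Ioo_of_sin_ne_zero hs₂).2 (hxm r hr t ht)
  have hden : ∀ y : ℝ, 0 < Real.sin γ + √(1 - y ^ 2) := fun y =>
    add_pos_of_pos_of_nonneg hγ (Real.sqrt_nonneg _)
  let v : ℝ × ℝ × ℝ → ℍ := fun p => quatMk (e (p.1, p.2.1))
    (-(2 * Real.sin γ * p.1 * capProfile p.2.1 ^ 2) + e (p.1, p.2.1) *
      (x (p.1, p.2.1) - Real.cos γ) / (Real.sin γ + √(1 - x (p.1, p.2.1) ^ 2)))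
    (Real.sin γ * (2 * capProfile p.2.1 * √(1 - (p.1 * capProfile p.2.1) ^ 2)) *
      Real.cos (2 * Real.pi * p.2.2))
    (Real.sin γ * (2 * capProfile p.2.1 * √(1 - (p.1 * capProfile p.2.1) ^ 2)) *
      Real.sin (2 * Real.pi * p.2.2))
  have hv : Continuous v := by
    rw [← continuousOn_univ]
    have h1 : Continuous fun p : ℝ × ℝ × ℝ => e (p.1, p.2.1) := he.comp (by fun_prop)
    have h2 : Continuous fun p : ℝ × ℝ × ℝ => x (p.1, p.2.1) := hx.comp (by fun_prop)
    refine continuousOn_quatMk h1.continuousOn ?_ (by fun_prop) (by fun_prop)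
    refine Continuous.continuousOn (Continuous.add (by fun_prop) ?_)
    exact (h1.mul (h2.sub continuous_const)).div (by fun_prop) fun p => (hden _).ne'
  have hrv : ∀ r ∈ Set.Icc (0 : ℝ) 1, ∀ t ∈ Set.Icc (0 : ℝ) 1, ∀ q : ℝ, r • v (r, t, q) =
      star (axisQuat (x (r, t))) + sphereQuat γ (r * capProfile t) q := by
    intro r hr t ht q
    have h1 := Real.sq_sqrt (show 0 ≤ 1 - x (r, t) ^ 2 by linarith [hx1 r hr t ht])
    have h2 := hden (x (r, t))
    have h3 : r * e (r, t) = x (r, t) + Real.cos γ := by simp only [x]; ring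
    simp only [v, axisQuat, sphereQuat]
    ext
    · simpa using h3
    · simp only [imI_smul, imI_add, imI_star, quatMk_imI, smul_eq_mul]
      generalize √(1 - x (r, t) ^ 2) = s at *
      rw [mul_add, ← mul_div_assoc, ← mul_assoc, h3]
      field_simp
      linear_combination h1 - Real.sin_sq_add_cos_sq γ
    · simp only [imJ_smul, imJ_add, imJ_star, quatMk_imJ, smul_eq_mul]; ring
    · simp only [imK_smul, imK_add, imK_star, quatMk_imK, smul_eq_mul]; ring
  have hrG : ∀ r ∈ Set.Icc (0 : ℝ) 1, ∀ t ∈ Set.Icc (0 : ℝ) 1, ∀ q : ℝ,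
      r • (axisQuat (x (r, t)) * v (r, t, q)) =
        1 + axisQuat (x (r, t)) * sphereQuat γ (r * capProfile t) q := by
    intro r hr t ht q
    rw [← mul_smul_comm, hrv r hr t ht q, one_add_axisQuat_mul_sphereQuat (hx1 r hr t ht).le]
  have hx0 : ∀ t, x (0, t) = -Real.cos γ := fun t => by simp only [x]; ring
  have he00 : ∀ t, e (0, t) = h * slideProfile t := fun t => by simp only [e]; ring
  have hsqrt : √(1 - (-Real.cos γ) ^ 2) = Real.sin γ := by
    rw [neg_sq, ← Real.abs_sin_eq_sqrt_one_sub_cos_sq, abs_of_pos hγ]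
  refine (trig_sign_of_family hα hs₁ hs₂ hw hodd x hx hxm (fun t ht => ?_) (fun t ht => ?_)
    (fun p => axisQuat (x (p.1, p.2.1)) * v p)
    ?_ (fun p hp => ?_) (fun r hr t ht q hq => ?_) (fun r hr t ht => ?_) (fun r hr q hq => ?_)
    (fun t ht q hq => ?_) hA hB hC).2 (fun t ht q hq => ?_)
  · have hs := slideProfile_left ht.2
    simp only [x]; rw [hneg 1 t (by rw [hs]; norm_num), hs, ha]; ring
  · have hs := slideProfile_right ht.1
    simp only [x]; rw [hpos 1 t (by rw [hs]; norm_num), hs, hb]; ring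
  · exact ((continuous_axisQuat.comp (hx.comp (by fun_prop))).mul hv).continuousOn
  · obtain ⟨hr, ht, hq⟩ := unitCube_mem hp
    refine mul_ne_zero (ne_zero_of_normSq_eq_one (normSq_axisQuat (hx1 _ hr _ ht).le)) fun h0 => ?_
    have c1 : e (p.1, p.2.1) = 0 := congrArg QuaternionAlgebra.re h0
    have c2 := congrArg QuaternionAlgebra.imI h0
    have c3 := congrArg QuaternionAlgebra.imJ h0
    have c4 := congrArg QuaternionAlgebra.imK h0
    have hcap := capProfile_of_slideProfile_eq_zero (he0 _ hr _ c1)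
    simp only [v, quatMk_imI, quatMk_imJ, quatMk_imK, c1, hcap, imI_zero, imJ_zero, imK_zero]
      at c2 c3 c4
    have hr0 : p.1 = 0 := by
      simpa [hγ.ne'] using c2
    rw [hr0] at c3 c4
    norm_num [hγ.ne'] at c3 c4
    have := Real.sin_sq_add_cos_sq (2 * Real.pi * p.2.2)
    rw [c3, c4] at this
    norm_num at this
  · rcases eq_or_lt_of_le hr.1 with h0 | h0
    · rw [← h0]
      have hQ : axisQuat (x (0, t)) * sphereQuat γ (0 * capProfile t) q = -1 := by
        rw [zero_mul, sphereQuat_zero, hx0, axisQuat, hsqrt]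
        have := Real.sin_sq_add_cos_sq γ
        ext <;> simp [Quaternion.re_mul, Quaternion.imI_mul, Quaternion.imJ_mul,
          Quaternion.imK_mul] <;> linarith
      have hre : (axisQuat (x (0, t)) * v (0, t, q)).re = 0 := by
        rw [Quaternion.re_mul, hx0, axisQuat, hsqrt]
        simp only [v, quatMk_re, quatMk_imI, quatMk_imJ, quatMk_imK, hx0, he00, hsqrt]
        field_simp
        ring
      refine ⟨normSq (axisQuat (x (0, t)) * v (0, t, q)), ?_⟩
      rw [hQ, ← pow_two, sq_eq_neg_normSq.mpr hre, smul_neg, ← coe_mul_eq_smul, mul_one]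
    · have hG : axisQuat (x (r, t)) * v (r, t, q) =
          r⁻¹ • (1 + axisQuat (x (r, t)) * sphereQuat γ (r * capProfile t) q) := by
        rw [← hrG r hr t ht q, smul_smul, inv_mul_cancel₀ h0.ne', one_smul]
      simp only [hG]
      rw [smul_mul_smul_comm, one_add_mul_self (normSq_axisQuat_mul_sphereQuat (hx1 r hr t ht).le
        (mul_capProfile_sq_le_one hr ht) _ _), smul_smul]
      exact ⟨_, rfl⟩
  · congr 1
    simp only [v]
    simp
  · simp only [v, capProfile_zero, capProfile_one]
    simp
  · have := hrG 1 ⟨zero_le_one, le_rfl⟩ t ht q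
    rwa [one_smul, one_mul] at this
  · refine ⟨by rw [hx0, hx0], ?_⟩
    simp only [hx0]
    rw [← mul_neg]
    congr 1
    have h1 : 2 * Real.pi * (q + 1 / 2) = 2 * Real.pi * q + Real.pi := by ring
    simp only [v, hx0, he00, slideProfile_symm, capProfile_symm, h1, Real.cos_add_pi,
      Real.sin_add_pi]
    ext <;> simp
    ring

theorem IsQuasiPrime.three_le {n : ℕ} (h : IsQuasiPrime n) : 3 ≤ n := by
  rcases h with rfl | ⟨hp, hodd⟩
  · norm_num
  · have h1 := hp.two_le
    obtain ⟨m, rfl⟩ := hodd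
    omega

theorem IsQuasiPrime.coprime {m n : ℕ} (hm : IsQuasiPrime m) (hn : IsQuasiPrime n) (h : m ≠ n) :
    m.Coprime n := by
  have h4 : ∀ {p : ℕ}, Odd p → Nat.Coprime 4 p := fun {p} hp =>
    Nat.Coprime.pow_left 2 (Nat.coprime_two_left.mpr hp)
  rcases hm with rfl | ⟨hp, hpo⟩ <;> rcases hn with rfl | ⟨hq, hqo⟩
  · exact absurd rfl h
  · exact h4 hqo
  · exact (h4 hpo).symm
  · exact (Nat.coprime_primes hp hq).mpr h

theorem IsQuasiPrime.isCoprime_two_mul {n : ℕ} (h : IsQuasiPrime n) {A : ℤ} (hA : Odd A)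
    (hn : n.Prime → ¬ (n : ℤ) ∣ A) : IsCoprime A (2 * n : ℤ) := by
  have h2 : IsCoprime A 2 := (Int.isCoprime_iff_gcd_eq_one.mpr (by
    rw [Int.gcd_comm]
    exact (Int.isCoprime_iff_gcd_eq_one.mp
      ((Prime.coprime_iff_not_dvd Int.prime_two).mpr fun h => by
        rw [← even_iff_two_dvd] at h
        exact (Int.not_even_iff_odd.mpr hA) h))))
  refine IsCoprime.mul_right h2 ?_
  rcases h with rfl | ⟨hp, -⟩
  · simpa using (IsCoprime.pow_right h2 : IsCoprime A (2 ^ 2))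
  · exact ((Prime.coprime_iff_not_dvd (Nat.prime_iff_prime_int.mp hp)).mpr (hn hp)).symm

/-- For a quasi-prime `n` some multiple of `π / n` has its cosine in `[0, 1/2]`. -/
theorem IsQuasiPrime.exists_cos_mem {n : ℕ} (h : IsQuasiPrime n) :
    ∃ j : ℤ, ¬ (n : ℤ) ∣ j ∧ Real.cos (j * (Real.pi / n)) ∈ Set.Icc (0 : ℝ) (1 / 2) := by
  rcases h with rfl | ⟨hp, hodd⟩
  · refine ⟨2, by norm_num, ?_⟩
    have : ((2 : ℤ) : ℝ) * (Real.pi / (4 : ℕ)) = Real.pi / 2 := by push_cast; ring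
    rw [this, Real.cos_pi_div_two]
    norm_num
  · obtain ⟨m, rfl⟩ := hodd
    have hm : 1 ≤ m := by
      have := hp.two_le
      omega
    have hm' : (1 : ℝ) ≤ m := by exact_mod_cast hm
    have hpi := Real.pi_pos
    refine ⟨m, fun hd => ?_, ?_, ?_⟩
    · have := Nat.le_of_dvd (by omega) (Int.natCast_dvd_natCast.mp hd)
      omega
    · apply Real.cos_nonneg_of_neg_pi_div_two_le_of_le
      · have : (0 : ℝ) ≤ ((m : ℤ) : ℝ) * (Real.pi / ((2 * m + 1 : ℕ) : ℝ)) := by positivity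
        linarith
      · push_cast
        rw [← mul_div_assoc, div_le_div_iff₀ (by positivity) (by norm_num)]
        nlinarith
    · rw [← Real.cos_pi_div_three]
      apply Real.cos_le_cos_of_nonneg_of_le_pi (by positivity)
      · push_cast
        rw [← mul_div_assoc, div_le_iff₀ (by positivity)]
        nlinarith
      · push_cast
        rw [← mul_div_assoc, div_le_div_iff₀ (by norm_num) (by positivity)]
        nlinarith

theorem exists_angle {n : ℕ} (hn : 0 < n) {A j : ℤ} (hA : IsCoprime A (2 * n : ℤ))
    (hj : ¬ (n : ℤ) ∣ j) : ∃ k : ℕ, 0 < k ∧ k < n ∧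
      Real.cos (A * (k * (Real.pi / n))) = Real.cos (j * (Real.pi / n)) := by
  have hn0 : (n : ℝ) ≠ 0 := by positivity
  obtain ⟨u, v, huv⟩ := hA
  have key : ∀ k m : ℤ, A * k = j + 2 * n * m →
      Real.cos (A * (k * (Real.pi / n))) = Real.cos (j * (Real.pi / n)) := by
    intro k m h
    have h' : (A : ℝ) * k = j + 2 * n * m := by exact_mod_cast h
    rw [← mul_assoc, h', add_mul, show 2 * (n : ℝ) * m * (Real.pi / n) = m * (2 * Real.pi) by
      field_simp, Real.cos_add_int_mul_two_pi]
  have hpos : (0 : ℤ) < 2 * n := by positivity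
  obtain ⟨k, hk0, hk1, m, hm⟩ : ∃ k : ℤ, 0 ≤ k ∧ k < 2 * n ∧ ∃ m, A * k = j + 2 * n * m := by
    refine ⟨(u * j) % (2 * n), Int.emod_nonneg _ hpos.ne', Int.emod_lt_of_pos _ hpos,
      -(v * j) - A * (u * j / (2 * n)), ?_⟩
    have h1 := Int.emod_add_mul_ediv (u * j) (2 * n)
    linear_combination A * h1 + j * huv
  have hnk : ¬ (n : ℤ) ∣ k := fun hd => hj <| by
    have : j = A * k - n * (2 * m) := by linear_combination -hm
    rw [this]
    exact dvd_sub (hd.mul_left _) (dvd_mul_right _ _)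
  have hne0 : k ≠ 0 := fun h => hnk (h ▸ dvd_zero _)
  have hnen : k ≠ n := fun h => hnk (h ▸ dvd_rfl)
  rcases lt_or_ge k n with hlt | hge
  · refine ⟨k.toNat, by omega, by omega, ?_⟩
    have hc : ((k.toNat : ℕ) : ℝ) = k := by exact_mod_cast Int.toNat_of_nonneg hk0
    rw [hc, key k m hm]
  · refine ⟨(2 * n - k).toNat, by omega, by omega, ?_⟩
    have hc : (((2 * n - k).toNat : ℕ) : ℝ) = 2 * n - k := by
      exact_mod_cast Int.toNat_of_nonneg (by omega : 0 ≤ 2 * (n : ℤ) - k)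
    rw [hc, ← key k m hm, ← Real.cos_neg, ← Real.cos_add_int_mul_two_pi _ A]
    congr 1
    field_simp
    ring

theorem sin_mul_pi_div_pos {n k : ℕ} (h0 : 0 < k) (h1 : k < n) :
    0 < Real.sin (k * (Real.pi / n)) := by
  have hn : (0 : ℝ) < n := by exact_mod_cast h0.trans h1
  have hk : (k : ℝ) < n := by exact_mod_cast h1
  apply Real.sin_pos_of_pos_of_lt_pi
  · have : (0 : ℝ) < k := by exact_mod_cast h0
    positivity
  · rw [← mul_div_assoc, div_lt_iff₀ hn, mul_comm]
    exact mul_lt_mul_of_pos_left hk Real.pi_pos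

theorem add_mul_pi_div_ne {n d k : ℕ} (hd : d ≠ 0) (hnd : n.Coprime d) (h0 : 0 < k) (h1 : k < n)
    (m l : ℤ) : k * (Real.pi / n) + m * (Real.pi / d) ≠ l * Real.pi := by
  intro h
  have hn : (n : ℝ) ≠ 0 := by exact_mod_cast (h0.trans h1).ne'
  have hd' : (d : ℝ) ≠ 0 := by exact_mod_cast hd
  have hpi := Real.pi_ne_zero
  field_simp at h
  have h2 : (k : ℤ) * d = n * (d * l - m) := by
    have : (k : ℝ) * d = n * (d * l - m) := by linear_combination h
    exact_mod_cast this
  have h3 : (n : ℤ) ∣ ((k * d : ℕ) : ℤ) := ⟨_, by rw [← h2]; push_cast; rfl⟩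
  have h4 := Nat.le_of_dvd h0 (hnd.dvd_of_dvd_mul_right (Int.natCast_dvd_natCast.mp h3))
  omega

theorem cos_add_cos_ne_zero {θ γ : ℝ} (h₁ : ∀ l : ℤ, θ + γ ≠ l * Real.pi)
    (h₂ : ∀ l : ℤ, θ - γ ≠ l * Real.pi) : Real.cos θ + Real.cos γ ≠ 0 := by
  intro h
  have h' : Real.cos θ = Real.cos (γ + Real.pi) := by rw [Real.cos_add_pi]; linarith
  obtain ⟨k, hk | hk⟩ := Real.cos_eq_cos_iff.mp h'
  · exact h₂ (1 - 2 * k) (by push_cast; linear_combination -hk)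
  · exact h₁ (2 * k - 1) (by push_cast; linear_combination hk)

theorem sin_ne_zero_of_ne {θ : ℝ} (h : ∀ l : ℤ, θ ≠ l * Real.pi) : Real.sin θ ≠ 0 := fun h0 => by
  obtain ⟨l, hl⟩ := Real.sin_eq_zero_iff.mp h0
  exact h l hl.symm

theorem cos_sub_cos_mul_neg {A B C : ℝ} (hp : Real.cos A ∈ Set.Icc (0 : ℝ) (1 / 2))
    (hq : Real.cos B ∈ Set.Icc (0 : ℝ) (1 / 2)) (hr : Real.cos C ∈ Set.Icc (0 : ℝ) (1 / 2)) :
    (Real.cos C - Real.cos (A + B)) * (Real.cos C - Real.cos (A - B)) < 0 := by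
  have h1 : (Real.cos C - Real.cos (A + B)) * (Real.cos C - Real.cos (A - B)) =
      (Real.cos C - Real.cos A * Real.cos B) ^ 2 -
        (1 - Real.cos A ^ 2) * (1 - Real.cos B ^ 2) := by
    rw [Real.cos_add, Real.cos_sub, ← Real.sin_sq, ← Real.sin_sq]
    ring
  rw [h1]
  generalize Real.cos A = p at *
  generalize Real.cos B = q at *
  generalize Real.cos C = r at *
  have hpq : p * q ≤ 1 / 2 * (1 / 2) := mul_le_mul hp.2 hq.2 hq.1 (by norm_num)
  have hpq0 := mul_nonneg hp.1 hq.1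
  have h2 : (r - p * q) ^ 2 ≤ (1 / 2) ^ 2 := sq_le_sq' (by linarith [hr.1]) (by linarith [hr.2])
  have h3 : p ^ 2 ≤ (1 / 2) ^ 2 := pow_le_pow_left₀ hp.1 hp.2 2
  have h4 : q ^ 2 ≤ (1 / 2) ^ 2 := pow_le_pow_left₀ hq.1 hq.2 2
  have h5 : (3 / 4 : ℝ) * (3 / 4) ≤ (1 - p ^ 2) * (1 - q ^ 2) :=
    mul_le_mul (by linarith) (by linarith) (by norm_num) (by linarith)
  linarith

theorem expSum_linear (n : ℤ) (v v' : Gen → ℤ) (w : FreeGroup Gen) :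
    expSum (fun g => n * v g + v' g) w = n * expSum v w + expSum v' w := by
  induction w using FreeGroup.induction_on with
  | C1 => simp [expSum_one]
  | of g => simp [expSum_of]
  | inv_of g ih => rw [expSum_inv, ih, expSum_inv, expSum_inv]; ring
  | mul w w' hw hw' => rw [expSum_mul, hw, hw', expSum_mul, expSum_mul]; ring

theorem expSum_pow (v : Gen → ℤ) (w : FreeGroup Gen) (n : ℕ) :
    expSum v (w ^ n) = n * expSum v w := by simp [expSum]

theorem lift_ofAdd_intCast (n : ℕ) (v : Gen → ℤ) (w : FreeGroup Gen) :
    FreeGroup.lift (fun g => Multiplicative.ofAdd ((v g : ℤ) : ZMod n)) w =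
      Multiplicative.ofAdd ((expSum v w : ℤ) : ZMod n) := by
  induction w using FreeGroup.induction_on with
  | C1 => simp [expSum_one]
  | of g => simp [expSum_of]
  | inv_of g ih => rw [map_inv, ih, expSum_inv, Int.cast_neg, ofAdd_neg]
  | mul w w' hw hw' => rw [map_mul, hw, hw', expSum_mul, Int.cast_add, ofAdd_add]

theorem not_dvd_expSum {R : Set (FreeGroup Gen)} {w : FreeGroup Gen}
    (hw : Subgroup.normalClosure {PresentedGroup.mk R w} = ⊤) {n : ℕ} {v : Gen → ℤ}
    (hR : ∀ r ∈ R, (n : ℤ) ∣ expSum v r) {g : Gen} (hg : ¬ (n : ℤ) ∣ v g) :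
    ¬ (n : ℤ) ∣ expSum v w := by
  intro hd
  let f : Gen → Multiplicative (ZMod n) := fun g => Multiplicative.ofAdd ((v g : ℤ) : ZMod n)
  have hval : ∀ r, (n : ℤ) ∣ expSum v r → FreeGroup.lift f r = 1 := fun r hr => by
    rw [lift_ofAdd_intCast, (ZMod.intCast_zmod_eq_zero_iff_dvd _ _).mpr hr, ofAdd_zero]
  let φ := PresentedGroup.toGroup (fun r hr => hval r (hR r hr))
  have hker : Subgroup.normalClosure {PresentedGroup.mk R w} ≤ φ.ker :=
    Subgroup.normalClosure_le_normal (Set.singleton_subset_iff.mpr (hval w hd))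
  have hg1 : φ (PresentedGroup.of g) = 1 := hker (hw ▸ Subgroup.mem_top _)
  rw [PresentedGroup.toGroup.of] at hg1
  exact hg ((ZMod.intCast_zmod_eq_zero_iff_dvd _ _).mp (ofAdd_eq_one.mp hg1))

theorem dvd_expSum_relators {a b c n : ℕ} {v : Gen → ℤ}
    (hu : (n : ℤ) ∣ 2 * v .u - (v .x + v .y + v .z)) (hx : (n : ℤ) ∣ a * v .x)
    (hy : (n : ℤ) ∣ b * v .y) (hz : (n : ℤ) ∣ c * v .z) :
    ∀ r ∈ relators a b c, (n : ℤ) ∣ expSum v r := by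
  rintro r (rfl | rfl | rfl | rfl)
  · simpa only [expSum_mul, expSum_inv, expSum_pow, expSum_of, Nat.cast_ofNat, sub_eq_add_neg]
      using hu
  all_goals rw [expSum_pow, expSum_of]; assumption

theorem odd_expSum_u {a b c : ℕ} {w : FreeGroup Gen}
    (hw : Subgroup.normalClosure {PresentedGroup.mk (relators a b c) w} = ⊤) :
    Odd (expSum (genWeight .u) w) := by
  rw [← Int.not_even_iff_odd, even_iff_two_dvd]
  exact not_dvd_expSum (n := 2) hw
    (dvd_expSum_relators (by simp [genWeight]) (by simp [genWeight]) (by simp [genWeight])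
      (by simp [genWeight])) (g := .u) (by simp [genWeight])

theorem exists_angle_of_normalClosure {a b c n : ℕ} {w : FreeGroup Gen}
    (hw : Subgroup.normalClosure {PresentedGroup.mk (relators a b c) w} = ⊤)
    (hn : IsQuasiPrime n) {g : Gen}
    (hg : g = .x ∧ n = a ∨ g = .y ∧ n = b ∨ g = .z ∧ n = c) :
    ∃ k : ℕ, 0 < k ∧ k < n ∧
      Real.cos ((2 * expSum (genWeight g) w + expSum (genWeight .u) w : ℤ) *
        (k * (Real.pi / n))) ∈ Set.Icc (0 : ℝ) (1 / 2) := by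
  have hodd : Odd (2 * expSum (genWeight g) w + expSum (genWeight .u) w) :=
    (even_two_mul _).add_odd (odd_expSum_u hw)
  have hndvd : n.Prime → ¬ (n : ℤ) ∣ 2 * expSum (genWeight g) w + expSum (genWeight .u) w := by
    intro hp
    rw [← expSum_linear]
    refine not_dvd_expSum hw ?_ (g := .u) ?_
    · rcases hg with ⟨rfl, rfl⟩ | ⟨rfl, rfl⟩ | ⟨rfl, rfl⟩ <;>
        exact dvd_expSum_relators (by simp [genWeight]) (by simp [genWeight])
          (by simp [genWeight]) (by simp [genWeight])
    · have h1 : ¬ (n : ℤ) ∣ 1 := fun h => hp.one_lt.ne' (by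
        exact_mod_cast Int.eq_one_of_dvd_one (by positivity) h)
      rcases hg with ⟨rfl, rfl⟩ | ⟨rfl, rfl⟩ | ⟨rfl, rfl⟩ <;> simpa [genWeight] using h1
  obtain ⟨j, hj, hcos⟩ := hn.exists_cos_mem
  obtain ⟨k, h0, h1, h2⟩ := exists_angle (by have := hn.three_le; omega)
    (hn.isCoprime_two_mul hodd hndvd) hj
  exact ⟨k, h0, h1, h2 ▸ hcos⟩

theorem normalClosure_singleton_ne_top {a b c : ℕ} (ha : IsQuasiPrime a) (hb : IsQuasiPrime b)
    (hc : IsQuasiPrime c) (hab : a ≠ b) (hac : a ≠ c)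
    (g : OrbifoldQuotient a b c) : Subgroup.normalClosure {g} ≠ ⊤ := by
  obtain ⟨w, rfl⟩ := PresentedGroup.mk_surjective _ g
  intro hw
  obtain ⟨k, hk0, hk1, hp⟩ := exists_angle_of_normalClosure hw ha (.inl ⟨rfl, rfl⟩)
  obtain ⟨l, hl0, hl1, hq⟩ := exists_angle_of_normalClosure hw hb (.inr (.inl ⟨rfl, rfl⟩))
  obtain ⟨m, hm0, hm1, hr⟩ := exists_angle_of_normalClosure hw hc (.inr (.inr ⟨rfl, rfl⟩))
  have hneg := cos_sub_cos_mul_neg hp hq hr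
  have hα := sin_mul_pi_div_pos hk0 hk1
  have hβ := sin_mul_pi_div_pos hl0 hl1
  have hγ := sin_mul_pi_div_pos hm0 hm1
  have hapos : (a : ℝ) ≠ 0 := by exact_mod_cast (hk0.trans hk1).ne'
  have hbpos : b ≠ 0 := (hl0.trans hl1).ne'
  have hcpos : c ≠ 0 := (hm0.trans hm1).ne'
  have hbpos' : (b : ℝ) ≠ 0 := by exact_mod_cast hbpos
  have hcpos' : (c : ℝ) ≠ 0 := by exact_mod_cast hcpos
  have hcop := ha.coprime hb hab
  have hcop' : a.Coprime (b * c) := hcop.mul_right (ha.coprime hc hac)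
  have key₁ := add_mul_pi_div_ne hbpos hcop hk0 hk1
  have key₂ := add_mul_pi_div_ne (mul_ne_zero hbpos hcpos) hcop' hk0 hk1
  have hs₁ : Real.sin (k * (Real.pi / a) + l * (Real.pi / b)) ≠ 0 :=
    sin_ne_zero_of_ne fun i => by exact_mod_cast key₁ l i
  have hs₂ : Real.sin (k * (Real.pi / a) - l * (Real.pi / b)) ≠ 0 :=
    sin_ne_zero_of_ne fun i => by
      have := key₁ (-l) i
      push_cast at this
      rwa [neg_mul, ← sub_eq_add_neg] at this
  have hc₁ : Real.cos (k * (Real.pi / a) + l * (Real.pi / b)) + Real.cos (m * (Real.pi / c)) ≠ 0 :=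
    cos_add_cos_ne_zero
      (fun i hi => key₂ (l * c + m * b) i (by rw [← hi]; push_cast; field_simp; ring))
      (fun i hi => key₂ (l * c - m * b) i (by rw [← hi]; push_cast; field_simp; ring))
  have hc₂ : Real.cos (k * (Real.pi / a) - l * (Real.pi / b)) + Real.cos (m * (Real.pi / c)) ≠ 0 :=
    cos_add_cos_ne_zero
      (fun i hi => key₂ (-l * c + m * b) i (by rw [← hi]; push_cast; field_simp; ring))
      (fun i hi => key₂ (-l * c - m * b) i (by rw [← hi]; push_cast; field_simp; ring))
  have haα : (a : ℝ) * (k * (Real.pi / a)) = k * Real.pi := by field_simp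
  have hbβ : (b : ℝ) * (l * (Real.pi / b)) = l * Real.pi := by field_simp
  have hcγ : (c : ℝ) * (m * (Real.pi / c)) = m * Real.pi := by field_simp
  generalize (k : ℝ) * (Real.pi / a) = α at *
  generalize (l : ℝ) * (Real.pi / b) = β at *
  generalize (m : ℝ) * (Real.pi / c) = γ at *
  have hlt : Real.cos (α + β) < Real.cos (α - β) := by
    rw [Real.cos_add, Real.cos_sub]
    linarith [mul_pos hα hβ]
  have hrep : ∀ f : Gen → ℍ, (∀ g, f g ≠ 0) →
      (∃ s : ℝ, f .u * f .u = s • (f .x * f .y * f .z)) →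
      (f .x).re = Real.cos α → normSq (f .x) = 1 → (f .y).re = Real.cos β → normSq (f .y) = 1 →
      (f .z).re = Real.cos γ → normSq (f .z) = 1 → (wordVal f w).im ≠ 0 := by
    intro f h0 hu hx hx1 hy hy1 hz hz1
    refine im_wordVal_ne_zero hw h0 hu (im_pow_eq_zero hx hx1 hα.ne' haα)
      (im_pow_eq_zero hy hy1 hβ.ne' hbβ) (im_pow_eq_zero hz hz1 hγ.ne' hcγ) fun him => ?_
    have h1 : f .x = ((f .x).re : ℍ) := by
      conv_lhs => rw [← re_add_im (f .x), him, add_zero]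
    rw [h1, normSq_coe, hx] at hx1
    have := Real.sin_sq_add_cos_sq α
    have := pow_pos hα 2
    linarith
  have hodd := odd_expSum_u hw
  rcases lt_or_gt_of_ne (mul_ne_zero hc₁ hc₂) with hsing | hreg
  · have h := trig_sign_of_singular hα hγ hs₁ hs₂ hrep hodd rfl rfl rfl
      (by nlinarith) (by nlinarith)
    exact absurd h (mul_pos_of_neg_of_neg hsing hneg).not_gt
  · have h := trig_sign_of_regular hα hs₁ hs₂ hlt hrep hodd rfl rfl rfl hreg
    exact absurd h (mul_neg_of_pos_of_neg hreg hneg).not_gt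

theorem normalClosure_u_x {a b c : ℕ} (hbc : b.Coprime c) :
    Subgroup.normalClosure {(PresentedGroup.of .u : OrbifoldQuotient a b c),
      PresentedGroup.of .x} = ⊤ := by
  set N := Subgroup.normalClosure {(PresentedGroup.of .u : OrbifoldQuotient a b c),
      PresentedGroup.of .x} with hN
  have hrel : ∀ r ∈ relators a b c, PresentedGroup.mk (relators a b c) r = 1 := fun r hr =>
    PresentedGroup.one_of_mem hr
  let π := QuotientGroup.mk' N
  have hu : π (PresentedGroup.of .u) = 1 := (QuotientGroup.eq_one_iff _).mpr
    (Subgroup.subset_normalClosure (Set.mem_insert _ _))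
  have hx : π (PresentedGroup.of .x) = 1 := (QuotientGroup.eq_one_iff _).mpr
    (Subgroup.subset_normalClosure (Set.mem_insert_of_mem _ rfl))
  have hyb : π (PresentedGroup.of .y) ^ b = 1 := by
    rw [← map_pow]
    exact (congrArg π (hrel _ (.inr (.inr (.inl rfl))))).trans (map_one π)
  have hzc : π (PresentedGroup.of .z) ^ c = 1 := by
    rw [← map_pow]
    exact (congrArg π (hrel _ (.inr (.inr (.inr rfl))))).trans (map_one π)
  have hyz : π (PresentedGroup.of .y) * π (PresentedGroup.of .z) = 1 := by
    have h1 : π (PresentedGroup.of .u ^ 2 * (PresentedGroup.of .x * PresentedGroup.of .y *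
        PresentedGroup.of .z)⁻¹) = 1 :=
      (congrArg π (hrel _ (.inl rfl))).trans (map_one π)
    rw [map_mul, map_pow, map_inv, map_mul, map_mul, hu, hx, one_pow, one_mul, one_mul,
      inv_eq_one] at h1
    exact h1
  have hy : π (PresentedGroup.of .y) = 1 := by
    have hyc : π (PresentedGroup.of .y) ^ c = 1 := by
      rw [eq_inv_of_mul_eq_one_left hyz, inv_pow, hzc, inv_one]
    have h1 := Nat.dvd_gcd (orderOf_dvd_of_pow_eq_one hyb) (orderOf_dvd_of_pow_eq_one hyc)
    rw [hbc.gcd_eq_one, Nat.dvd_one, orderOf_eq_one_iff] at h1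
    exact h1
  have hz : π (PresentedGroup.of .z) = 1 := by rwa [hy, one_mul] at hyz
  rw [eq_top_iff, ← PresentedGroup.closure_range_of, Subgroup.closure_le]
  rintro _ ⟨g, rfl⟩
  apply (QuotientGroup.eq_one_iff _).mp
  cases g
  exacts [hu, hx, hy, hz]

theorem lemma3 (a b c : ℕ)
    (ha : IsQuasiPrime a) (hb : IsQuasiPrime b) (hc : IsQuasiPrime c)
    (hab : a ≠ b) (hac : a ≠ c) (hbc : b ≠ c)
    (hne : ({a, b, c} : Set ℕ) ≠ {3, 4, 5}) :
    Group.weight (OrbifoldQuotient a b c) = 2 := by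
  apply le_antisymm
  · refine le_trans (iInf₂_le ({PresentedGroup.of .u, PresentedGroup.of .x} :
      Set (OrbifoldQuotient a b c)) (normalClosure_u_x (hb.coprime hc hbc))) ?_
    exact (Set.encard_insert_le _ _).trans (by rw [Set.encard_singleton]; norm_num)
  · refine le_iInf₂ fun S hS => ?_
    by_contra hlt
    have h1 : S.encard ≤ 1 := Order.le_of_lt_succ (by
      simpa [Order.succ_eq_add_one, one_add_one_eq_two] using hlt)
    obtain ⟨g, hg⟩ : ∃ g, S ⊆ {g} := by
      rcases (Set.encard_le_one_iff_subsingleton.mp h1).eq_empty_or_singleton with h | ⟨g, h⟩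
      · exact ⟨1, h ▸ Set.empty_subset _⟩
      · exact ⟨g, h.le⟩
    exact normalClosure_singleton_ne_top ha hb hc hab hac g
      (top_le_iff.mp (hS.ge.trans (Subgroup.normalClosure_mono hg)))
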